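/- For $n\ge 1$ let $\mathbf P_n=\{\mathbf 1_2,\sigma^x,\sigma^y,\sigma^z\}^{\otimes n}\setminus\{\mathbf 1_{2^n}\}$ be the set of the $4^n-1$ nonidentity $n$-qubit Pauli operators, where $\sigma^x,\sigma^y,\sigma^z$ are the $2\times 2$ Pauli matrices. Write $\bar U$ for the entrywise complex conjugate of a matrix $U$ and $\|\cdot\|$ for the operator norm (greatest singular value). All expectations below are with respect to the uniform distributions on the indicated sets; for $\mathrm{SU}(2^n)$ this is the Haar probability measure. **Theorem.** For all integers $n,t\ge 1$, $$\left\|\mathop{\mathbb E}_{\theta\sim(-\pi,\pi)}\ \mathop{\mathbb E}_{P\sim\mathbf P_n}\left(e^{\mathrm i\frac\theta2 P}\otimes e^{-\mathrm i\frac\theta2\bar P}\right)^{\otimes t}-\mathop{\mathbb E}_{U\sim \mathrm{SU}(2^n)}\left(U\otimes\bar U\right)^{\otimes t}\right\|\ \le\ 1-\frac1{4t}-\frac1{4^n-1}.$$ In addition, for every integer $n\ge 1$ and every finite-dimensional (continuous) unitary representation $\rho$ of $\mathrm{SU}(2^n)$, $$\left\|\mathop{\mathbb E}_{\theta\sim(-2\pi,2\pi)}\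 \mathop{\mathbb E}_{P\sim\mathbf P_n}\rho\left(e^{\mathrm i\frac\theta2 P}\right)-\mathop{\mathbb E}_{U\sim \mathrm{SU}(2^n)}\rho(U)\right\|\ \le\ 1-\frac1{4^n-1}.$$ -/

import Mathlib

open MeasureTheory
open scoped Matrix Kronecker Matrix.Norms.L2Operator

noncomputable section

/-! ## Tensor products of matrices and Pauli operators -/

/-- The tensor product `A 0 ⊗ A 1 ⊗ ⋯ ⊗ A (k - 1)` of a finite family of square matrices, written
in the product basis: its `(x, y)` entry is `∏ j, (A j) (x j) (y j)`. -/
def matrixTensor {k : ℕ} {ι : Type*} (A : Fin k → Matrix ι ι ℂ) :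
    Matrix (Fin k → ι) (Fin k → ι) ℂ :=
  Matrix.of fun x y => ∏ j, A j (x j) (y j)

/-- The tensor power `A ^ ⊗ t`. -/
def matrixTensorPow {ι : Type*} (t : ℕ) (A : Matrix ι ι ℂ) :
    Matrix (Fin t → ι) (Fin t → ι) ℂ :=
  matrixTensor fun _ : Fin t => A

/-- The four one-qubit matrices `1, σˣ, σʸ, σᶻ`. -/
def sigma : Fin 4 → Matrix (Fin 2) (Fin 2) ℂ :=
  ![1, !![0, 1; 1, 0], !![0, -Complex.I; Complex.I, 0], !![1, 0; 0, -1]]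

/-- The index set of the computational basis of `n` qubits; it has `2 ^ n` elements. -/
abbrev Qubits (n : ℕ) : Type := Fin n → Fin 2

open Classical in
/-- The finite set `{1, σˣ, σʸ, σᶻ} ^ ⊗ n \ {1}` of nonidentity `n`-qubit Pauli operators. -/
def pauliSet (n : ℕ) : Finset (Matrix (Qubits n) (Qubits n) ℂ) :=
  (Finset.univ.image fun s : Fin n → Fin 4 => matrixTensor fun j => sigma (s j)).erase 1

/-- The average of `f` over the uniform distribution on the nonidentity Pauli operators. -/
def pauliMean (n : ℕ) {E : Type*} [AddCommGroup E] [Module ℝ E] (f : pauliSet n → E) : E :=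
  ((pauliSet n).card : ℝ)⁻¹ • ∑ P, f P

/-! ## The special unitary group and its Haar probability measure -/

/-- The group `SU(2 ^ n)` of special unitary matrices on `n` qubits. -/
abbrev SU (n : ℕ) := Matrix.specialUnitaryGroup (Qubits n) ℂ

instance instMeasurableSpaceSU (n : ℕ) : MeasurableSpace (SU n) := borel _

instance instBorelSpaceSU (n : ℕ) : BorelSpace (SU n) := ⟨rfl⟩

instance instIsTopologicalGroupSU (n : ℕ) : IsTopologicalGroup (SU n) where
  continuous_inv :=
    Continuous.subtype_mk (continuous_star.comp continuous_subtype_val) _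

instance instCompactSpaceSU (n : ℕ) : CompactSpace (SU n) := by
  apply isCompact_iff_compactSpace.mp
  have hc : IsClosed ((SU n : Submonoid _) : Set (Matrix (Qubits n) (Qubits n) ℂ)) := by
    have h1 : IsClosed {A : Matrix (Qubits n) (Qubits n) ℂ | A.det = 1} :=
      isClosed_eq (continuous_id.matrix_det) continuous_const
    exact (isClosed_unitary (R := Matrix (Qubits n) (Qubits n) ℂ)).inter h1
  have hk : IsCompact {A : Matrix (Qubits n) (Qubits n) ℂ |
      ∀ i j, A i j ∈ Metric.closedBall (0 : ℂ) 1} := by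
    have h : IsCompact (Set.univ.pi fun _ : Qubits n =>
        Set.univ.pi fun _ : Qubits n => Metric.closedBall (0 : ℂ) 1) :=
      isCompact_univ_pi fun _ => isCompact_univ_pi fun _ => isCompact_closedBall (0 : ℂ) 1
    simp only [Set.pi, Set.mem_univ, true_imp_iff, Set.mem_ofPred_eq] at h
    exact h
  refine hk.of_isClosed_subset hc fun A hA i j => ?_
  simpa using entry_norm_bound_of_unitary hA.1 i j

/-- The Haar probability measure on `SU(2 ^ n)`. -/
def haarSU (n : ℕ) : Measure (SU n) := Measure.haarMeasure ⊤

/-! ## Pauli rotations -/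

theorem exp_mem_specialUnitaryGroup {ι : Type*} [Fintype ι] [DecidableEq ι]
    {H : Matrix ι ι ℂ} (hH : H.IsHermitian) (htr : H.trace = 0) (a : ℝ) :
    NormedSpace.exp ((Complex.I * (a : ℂ)) • H) ∈ Matrix.specialUnitaryGroup ι ℂ := by
  rw [Matrix.mem_specialUnitaryGroup_iff, Matrix.mem_unitaryGroup_iff]
  constructor
  · have h : star ((Complex.I * (a : ℂ)) • H) = -((Complex.I * (a : ℂ)) • H) := by
      rw [star_smul, Matrix.star_eq_conjTranspose, hH.eq]
      simp
    rw [Matrix.star_eq_conjTranspose, ← Matrix.exp_conjTranspose, ← Matrix.star_eq_conjTranspose,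
      h, ← Matrix.exp_add_of_commute _ _ (Commute.neg_right (Commute.refl ((Complex.I * (a : ℂ)) • H))), add_neg_cancel,
      NormedSpace.exp_zero]
  · have hs := hH.spectral_theorem
    rw [Unitary.conjStarAlgAut_apply] at hs
    set V := hH.eigenvectorUnitary
    set D : Matrix ι ι ℂ :=
      Matrix.diagonal fun i => (Complex.I * (a : ℂ)) * (hH.eigenvalues i : ℂ) with hD
    have hV1 : (V : Matrix ι ι ℂ) * star (V : Matrix ι ι ℂ) = 1 := Unitary.coe_mul_star_self V
    have hV2 : star (V : Matrix ι ι ℂ) * (V : Matrix ι ι ℂ) = 1 := Unitary.coe_star_mul_self V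
    have hVinv : (V : Matrix ι ι ℂ)⁻¹ = star (V : Matrix ι ι ℂ) := Matrix.inv_eq_right_inv hV1
    have hVu : IsUnit (V : Matrix ι ι ℂ) := ⟨⟨_, _, hV1, hV2⟩, rfl⟩
    have he : (Complex.I * (a : ℂ)) • H = V * D * (V : Matrix ι ι ℂ)⁻¹ := by
      have hd : D = (Complex.I * (a : ℂ)) •
          Matrix.diagonal (RCLike.ofReal ∘ hH.eigenvalues : ι → ℂ) := by
        rw [hD, ← Matrix.diagonal_smul]
        rfl
      rw [hVinv, hd, Matrix.mul_smul, Matrix.smul_mul]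
      exact congrArg _ hs
    have hsum : ∑ i, (hH.eigenvalues i : ℂ) = 0 := by
      rw [← htr]
      exact hH.trace_eq_sum_eigenvalues.symm
    rw [he, Matrix.exp_conj _ _ hVu, Matrix.det_conj hVu, hD, Matrix.exp_diagonal,
      Matrix.det_diagonal]
    simp only [Pi.coe_exp, ← Complex.exp_eq_exp_ℂ]
    rw [← Complex.exp_sum, ← Finset.mul_sum, hsum, mul_zero, Complex.exp_zero]

theorem pauli_isHermitian {n : ℕ} (P : pauliSet n) : P.1.IsHermitian := by
  obtain ⟨P, hP⟩ := P
  obtain ⟨-, hP⟩ := Finset.mem_erase.mp hP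
  obtain ⟨s, -, rfl⟩ := Finset.mem_image.mp hP
  have hσ : ∀ k a b, star (sigma k a b) = sigma k b a := by
    intro k a b
    fin_cases k <;> fin_cases a <;> fin_cases b <;> simp [sigma]
  ext x y
  simp only [matrixTensor, Matrix.conjTranspose_apply, Matrix.of_apply, star_prod, hσ]

theorem pauli_trace {n : ℕ} (P : pauliSet n) : P.1.trace = 0 := by
  obtain ⟨P, hP⟩ := P
  obtain ⟨hP1, hP⟩ := Finset.mem_erase.mp hP
  obtain ⟨s, -, rfl⟩ := Finset.mem_image.mp hP
  have hs : ∃ j, s j ≠ 0 := by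
    by_contra! h
    apply hP1
    ext x y
    by_cases hxy : x = y
    · subst hxy
      simp [matrixTensor, h, sigma]
    · obtain ⟨j, hj⟩ := Function.ne_iff.mp hxy
      rw [Matrix.one_apply_ne hxy]
      exact Finset.prod_eq_zero (Finset.mem_univ j) (by simp [h, sigma, Matrix.one_apply_ne hj])
  obtain ⟨j, hj⟩ := hs
  have h0 : ∀ k : Fin 4, k ≠ 0 → ∑ a, sigma k a a = 0 := by
    intro k hk
    fin_cases k <;> simp_all [sigma]
  simp only [Matrix.trace, Matrix.diag_apply, matrixTensor, Matrix.of_apply]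
  rw [← Fintype.prod_sum fun j a => sigma (s j) a a]
  exact Finset.prod_eq_zero (Finset.mem_univ j) (h0 _ hj)

/-- The Pauli rotation `exp(i θ P / 2)`, as an element of `SU(2 ^ n)`. -/
def pauliRotation {n : ℕ} (P : pauliSet n) (θ : ℝ) : SU n :=
  ⟨NormedSpace.exp ((Complex.I * ((θ / 2 : ℝ) : ℂ)) • P.1),
    exp_mem_specialUnitaryGroup (pauli_isHermitian P) (pauli_trace P) (θ / 2)⟩

end

/-! Let `ρ` be a continuous unitary representation. Each Pauli string `P t` gives a self-adjoint
generator `h t` with `ρ (exp (i θ P t)) = exp (i θ h t)`. The function `exp (i θ P / 2)` has period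
`4π`, so averaging over `(-2π, 2π)` turns each rotation into the orthogonal projection onto `ker (h
t)`. The Haar average is the projection `Q` onto the joint kernel of all `h t`. The problem becomes
a bound on `M - Q`, where `M` is the mean of `m = 4 ^ n - 1` kernel projections.

The Casimir operator `C = ∑ h t ^ 2` commutes with every `h t`, hence with `M - Q`. Take a joint
eigenvector `x`, with eigenvalue of modulus `‖M - Q‖` for `M - Q` and `c` for `C`. If the first
eigenvalue is nonzero, then `Q x = 0`. Let `μ` be the largest norm of an `h t` on the `c`-eigenspace
`W` of `C`. The part of `x` orthogonal to `ker (h t)` has norm at least `‖h t x‖ / μ`. Summing over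
`t` gives `‖M - Q‖ ≤ 1 - c / (m μ²)`.

A highest-weight argument bounds `c` from below. Let `v` in `W` satisfy `h r v = ± μ v`. If `P t`
anticommutes with `P r`, a suitable combination of `h t v` and `h (r ⋆ t) v` would have eigenvalue
of modulus `μ + 2`, so it vanishes. This forces `‖h t v‖² + ‖h (r ⋆ t) v‖² = 2 μ ‖v‖²`. Exactly `4 ^
n / 2` strings anticommute with `P r`, so `c ≥ μ² + μ 4 ^ n / 2`.

The gap is therefore at least `(1 + 4 ^ n / (2 K)) / m` for any `K` bounding the norms `‖h t‖`. For
`(U ⊗ Ū) ^ ⊗ t` one may take `K = 2 t`; for general `ρ` the second summand is dropped. The main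
steps are `IsPauliFamily.norm_sq_add_norm_sq`, `IsPauliFamily.norm_mean_sub_le`,
`exists_linear_generator` and `norm_pauliMean_sub_haar_le`. -/

noncomputable section

/-! ### Spectral gap for a family of operators with Pauli commutation relations. -/

section CasimirGap

variable {V : Type*} [NormedAddCommGroup V] [InnerProductSpace ℂ V]

theorem inner_starProjection_self (U : Submodule ℂ V) [U.HasOrthogonalProjection] (x : V) :
    inner ℂ x (U.starProjection x) = ((‖U.starProjection x‖ ^ 2 : ℝ) : ℂ) := by
  conv_lhs => rw [← U.starProjection_eq_self_iff.mpr (U.starProjection_apply_mem x)]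
  rw [← U.inner_starProjection_left_eq_right, inner_self_eq_norm_sq_to_K]
  push_cast
  rfl

/-- Commuting operators on a finite-dimensional space have a joint eigenvector in each
eigenspace of the first one. -/
theorem exists_joint_eigenvector [FiniteDimensional ℂ V] {T C : V →L[ℂ] V} (hTC : Commute T C)
    {z : ℂ} {x : V} (hx0 : x ≠ 0) (hx : T x = z • x) :
    ∃ y, y ≠ 0 ∧ T y = z • y ∧ ∃ c : ℂ, C y = c • y := by
  let E : Submodule ℂ V := Module.End.eigenspace (T : V →ₗ[ℂ] V) z
  have hE : ∀ y, y ∈ E ↔ T y = z • y := fun y => Module.End.mem_eigenspace_iff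
  have hCE : ∀ y ∈ E, (C : V →ₗ[ℂ] V) y ∈ E := by
    intro y hy
    rw [hE] at hy ⊢
    have := congrArg (fun f : V →L[ℂ] V => f y) hTC.eq
    change T (C y) = C (T y) at this
    change T (C y) = z • C y
    rw [this, hy, map_smul]
  have : Nontrivial E := ⟨⟨⟨x, (hE x).mpr hx⟩, 0, fun h => hx0 (congrArg Subtype.val h)⟩⟩
  obtain ⟨c, hc⟩ := Module.End.exists_eigenvalue ((C : V →ₗ[ℂ] V).restrict hCE)
  obtain ⟨y, hy⟩ := hc.exists_hasEigenvector
  refine ⟨y, fun h => hy.2 (Subtype.ext h), (hE _).mp y.2, c, ?_⟩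
  exact congrArg Subtype.val hy.apply_eq_smul

variable [CompleteSpace V]

/-- Self-adjoint operators indexed by `J` whose commutators are `[h r, h t] = 2 i b(r,t) h (r ⋆ t)`,
like those of the Pauli strings. -/
structure IsPauliFamily {J : Type*} (h : J → V →L[ℂ] V) (op : J → J → J) (b : J → J → ℝ) :
    Prop where
  selfAdjoint : ∀ t, IsSelfAdjoint (h t)
  commutator : ∀ r t, h r * h t - h t * h r = (2 * Complex.I * (b r t : ℂ)) • h (op r t)
  op_op : ∀ r t, op r (op r t) = t
  coeff_op : ∀ r t, b r (op r t) = -b r t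
  coeff_sq : ∀ r t, b r t ≠ 0 → b r t ^ 2 = 1
  op_right : ∀ r t, b r t ≠ 0 → op t (op r t) = r
  coeff_right : ∀ r t, b r t ≠ 0 → b t (op r t) = b r t

variable {J : Type*} {h : J → V →L[ℂ] V} {op : J → J → J}
  {b : J → J → ℝ}

/-- The involution `t ↦ op r t` swaps the two factors in each term of `[h r, ∑ h t ^ 2]` and flips
the sign of its coefficient, so the commutator equals its own negative. -/
theorem IsPauliFamily.commute_casimir [Fintype J] (H : IsPauliFamily h op b) (r : J) :
    Commute (h r) (∑ t, h t * h t) := by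
  have key : h r * (∑ t, h t * h t) - (∑ t, h t * h t) * h r =
      ∑ t, (2 * Complex.I * (b r t : ℂ)) • (h (op r t) * h t + h t * h (op r t)) := by
    rw [Finset.mul_sum, Finset.sum_mul, ← Finset.sum_sub_distrib]
    refine Finset.sum_congr rfl fun t _ => ?_
    rw [smul_add, ← smul_mul_assoc, ← mul_smul_comm, ← H.commutator]
    noncomm_ring
  let σ : Equiv.Perm J := ⟨op r, op r, H.op_op r, H.op_op r⟩
  have hσ := Equiv.sum_comp σ
    fun t => (2 * Complex.I * (b r t : ℂ)) • (h (op r t) * h t + h t * h (op r t))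
  have h2 : ∀ t, (2 * Complex.I * (b r (σ t) : ℂ)) •
      (h (op r (σ t)) * h (σ t) + h (σ t) * h (op r (σ t))) =
      -((2 * Complex.I * (b r t : ℂ)) • (h (op r t) * h t + h t * h (op r t))) := by
    intro t
    change (2 * Complex.I * (b r (op r t) : ℂ)) •
      (h (op r (op r t)) * h (op r t) + h (op r t) * h (op r (op r t))) = _
    rw [H.op_op, H.coeff_op, add_comm, ← neg_smul]
    push_cast
    ring_nf
  rw [Finset.sum_congr rfl fun t _ => h2 t, Finset.sum_neg_distrib] at hσ
  refine sub_eq_zero.mp (key.trans ((smul_eq_zero.mp ?_).resolve_left (two_ne_zero (α := ℂ))))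
  rw [two_smul]
  nth_rewrite 1 [← hσ]
  exact neg_add_cancel _

theorem inner_casimir_eq_sum_norm_sq [Fintype J] (hsa : ∀ t, IsSelfAdjoint (h t)) (v : V) :
    inner ℂ v ((∑ t, h t * h t) v) = ((∑ t, ‖h t v‖ ^ 2 : ℝ) : ℂ) := by
  rw [sum_apply, inner_sum]
  push_cast
  refine Finset.sum_congr rfl fun t _ => ?_
  change inner ℂ v (h t (h t v)) = _
  rw [← ContinuousLinearMap.adjoint_inner_left,
    ← ContinuousLinearMap.star_eq_adjoint, (hsa t).star_eq, inner_self_eq_norm_sq_to_K]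
  rfl

theorem IsPauliFamily.coeff_self (H : IsPauliFamily h op b) (r : J) : b r r = 0 := by
  by_contra hb
  have h1 := H.coeff_right r r hb
  rw [H.coeff_op] at h1
  exact hb (by linarith)

/-- On an eigenvector of `h r` for an eigenvalue of greatest modulus, an `h t` anticommuting
with `h r` acts as a ladder operator. -/
theorem IsPauliFamily.norm_sq_add_norm_sq (H : IsPauliFamily h op b) {W : Submodule ℂ V}
    (hW : ∀ t, ∀ y ∈ W, h t y ∈ W) {r : J} {μ s : ℝ} (hμ : 0 < μ) (hs : s ^ 2 = 1)
    (hmax : ∀ y ∈ W, ‖h r y‖ ≤ μ * ‖y‖) {v : V} (hv : v ∈ W)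
    (hvr : h r v = ((s * μ : ℝ) : ℂ) • v) {t : J} (hb : b r t ≠ 0) :
    ‖h t v‖ ^ 2 + ‖h (op r t) v‖ ^ 2 = 2 * μ * ‖v‖ ^ 2 := by
  have hb2 : (b r t : ℂ) ^ 2 = 1 := by exact_mod_cast H.coeff_sq r t hb
  have hs2 : (s : ℂ) ^ 2 = 1 := by exact_mod_cast hs
  set κ : ℂ := s * b r t with hκ
  -- The sign `κ` is chosen so that `e` is shifted away from zero: `h r e = s (μ + 2) e`, which
  -- exceeds the maximal modulus `μ` unless `e = 0`.
  set e : V := h t v + (Complex.I * κ) • h (op r t) v with he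
  have hκ2 : κ ^ 2 = 1 := by rw [hκ, mul_pow, hs2, hb2, one_mul]
  have heW : e ∈ W := W.add_mem (hW _ _ hv) (W.smul_mem _ (hW _ _ hv))
  have c1 : h r (h t v) = h t (h r v) + (2 * Complex.I * (b r t : ℂ)) • h (op r t) v := by
    have := congrArg (fun A : V →L[ℂ] V => A v) (H.commutator r t)
    simp only [sub_apply, mul_apply_eq_comp,
      smul_apply] at this
    rw [← this]; abel
  have c2 : h r (h (op r t) v) = h (op r t) (h r v) - (2 * Complex.I * (b r t : ℂ)) • h t v := by
    have := congrArg (fun A : V →L[ℂ] V => A v) (H.commutator r (op r t))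
    simp only [sub_apply, mul_apply_eq_comp,
      smul_apply, H.op_op, H.coeff_op] at this
    rw [sub_eq_iff_eq_add.mp this]
    push_cast
    module
  have hre : h r e = ((s * μ + 2 * s : ℝ) : ℂ) • e := by
    have hI := Complex.I_sq
    rw [he, map_add, map_smul, c1, c2, hvr, map_smul, map_smul]
    match_scalars
    · linear_combination (-2 * κ * (b r t : ℂ)) * hI + 2 * s * hb2
    · linear_combination (-2 * Complex.I * (b r t : ℂ)) * hs2
  have he0 : e = 0 := by
    have h1 := hmax e heW
    rw [hre, norm_smul, Complex.norm_real, Real.norm_eq_abs] at h1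
    have h2 : |s * μ + 2 * s| = μ + 2 := by
      rw [show s * μ + 2 * s = s * (μ + 2) by ring, abs_mul, (show |s| = 1 by rw [← Real.sqrt_sq_eq_abs, hs, Real.sqrt_one]),
        one_mul, abs_of_pos (by linarith)]
    rw [h2] at h1
    have h3 := norm_nonneg e
    exact norm_eq_zero.mp (by nlinarith)
  have e1 : h t v = -(Complex.I * κ) • h (op r t) v := by
    rw [neg_smul]; exact eq_neg_of_add_eq_zero_left he0
  have e2 : h (op r t) v = (Complex.I * κ) • h t v := by
    rw [e1, smul_smul, show Complex.I * κ * -(Complex.I * κ) = -(Complex.I ^ 2 * κ ^ 2) by ring,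
      hκ2, Complex.I_sq]
    simp
  have c3 : h t (h (op r t) v) - h (op r t) (h t v) = (2 * Complex.I * κ * μ) • v := by
    have := congrArg (fun A : V →L[ℂ] V => A v) (H.commutator t (op r t))
    simp only [sub_apply, mul_apply_eq_comp,
      smul_apply, H.op_right r t hb, H.coeff_right r t hb] at this
    rw [this, hvr, smul_smul, hκ]
    push_cast
    ring_nf
  have hsq : ∀ t, ((‖h t v‖ ^ 2 : ℝ) : ℂ) = inner ℂ v (h t (h t v)) := by
    intro t
    rw [← ContinuousLinearMap.adjoint_inner_left, ← ContinuousLinearMap.star_eq_adjoint,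
      (H.selfAdjoint t).star_eq, inner_self_eq_norm_sq_to_K]
    push_cast
    rfl
  -- Since `e = 0`, the sum of squares on `v` collapses to a multiple of the commutator `[h t, h (op
  -- r t)]`, which is proportional to `h r`.
  have hfin : h t (h t v) + h (op r t) (h (op r t) v) = ((2 * μ : ℝ) : ℂ) • v := by
    have a1 : h t (h t v) = -(Complex.I * κ) • h t (h (op r t) v) := by
      conv_lhs => rw [e1, map_smul]
    have a2 : h (op r t) (h (op r t) v) = (Complex.I * κ) • h (op r t) (h t v) := by
      conv_lhs => rw [e2, map_smul]
    have : h t (h t v) + h (op r t) (h (op r t) v) =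
        -(Complex.I * κ) • (h t (h (op r t) v) - h (op r t) (h t v)) := by
      rw [a1, a2]; module
    rw [this, c3, smul_smul]
    congr 1
    push_cast
    linear_combination (-2 * κ ^ 2 * μ) * Complex.I_sq + 2 * μ * hκ2
  have : (((‖h t v‖ ^ 2 + ‖h (op r t) v‖ ^ 2 : ℝ)) : ℂ) = ((2 * μ * ‖v‖ ^ 2 : ℝ) : ℂ) := by
    rw [Complex.ofReal_add, hsq, hsq, ← inner_add_right, hfin, inner_smul_right,
      inner_self_eq_norm_sq_to_K]
    push_cast
    rfl
  exact_mod_cast this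

/-- Summing the ladder identity over `t` with weights `b r t ^ 2` counts every anticommuting index
twice, which cancels the factor `2` in `2 * μ`. The index `r` itself contributes `μ ^ 2`; the
remaining terms are dropped. -/
theorem IsPauliFamily.le_sum_norm_sq [Fintype J] (H : IsPauliFamily h op b) {W : Submodule ℂ V}
    (hW : ∀ t, ∀ y ∈ W, h t y ∈ W) {r : J} {μ s : ℝ} (hμ : 0 < μ) (hs : s ^ 2 = 1)
    (hmax : ∀ y ∈ W, ‖h r y‖ ≤ μ * ‖y‖) {v : V} (hv : v ∈ W)
    (hvr : h r v = ((s * μ : ℝ) : ℂ) • v) :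
    (μ ^ 2 + μ * ∑ t, b r t ^ 2) * ‖v‖ ^ 2 ≤ ∑ t, ‖h t v‖ ^ 2 := by
  classical
  let σ : Equiv.Perm J := ⟨op r, op r, H.op_op r, H.op_op r⟩
  have h1 : ∑ t, b r t ^ 2 * ‖h (op r t) v‖ ^ 2 = ∑ t, b r t ^ 2 * ‖h t v‖ ^ 2 := by
    rw [← Equiv.sum_comp σ fun t => b r t ^ 2 * ‖h t v‖ ^ 2]
    refine Finset.sum_congr rfl fun t _ => ?_
    change _ = b r (op r t) ^ 2 * ‖h (op r t) v‖ ^ 2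
    rw [H.coeff_op, neg_sq]
  have h2 : ∑ t, b r t ^ 2 * (‖h t v‖ ^ 2 + ‖h (op r t) v‖ ^ 2) =
      ∑ t, b r t ^ 2 * (2 * μ * ‖v‖ ^ 2) := by
    refine Finset.sum_congr rfl fun t _ => ?_
    by_cases hb : b r t = 0
    · simp [hb]
    · rw [H.norm_sq_add_norm_sq hW hμ hs hmax hv hvr hb]
  simp_rw [mul_add] at h2
  rw [Finset.sum_add_distrib, h1, ← Finset.sum_mul] at h2
  have h3 : ‖h r v‖ ^ 2 = μ ^ 2 * ‖v‖ ^ 2 := by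
    rw [hvr, norm_smul, Complex.norm_real, Real.norm_eq_abs, mul_pow, sq_abs, mul_pow, hs, one_mul]
  have h4 : ∑ t, ((if t = r then ‖h r v‖ ^ 2 else 0) + b r t ^ 2 * ‖h t v‖ ^ 2) ≤
      ∑ t, ‖h t v‖ ^ 2 := by
    refine Finset.sum_le_sum fun t _ => ?_
    split_ifs with htr
    · subst htr
      simp [H.coeff_self]
    · by_cases hb : b r t = 0
      · simp [hb]
      · simp [H.coeff_sq r t hb]
  rw [Finset.sum_add_distrib, Finset.sum_ite_eq' Finset.univ r, if_pos (Finset.mem_univ r), h3] at h4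
  linarith

/-- A self-adjoint operator attains its norm on an invariant subspace at an eigenvector. -/
theorem exists_eigenvector_of_norm_le {a : V →L[ℂ] V} (ha : IsSelfAdjoint a) {W : Submodule ℂ V}
    (hW : ∀ y ∈ W, a y ∈ W) {μ : ℝ} (hmax : ∀ y ∈ W, ‖a y‖ ≤ μ * ‖y‖) {y : V} (hy : y ∈ W)
    (hy1 : ‖y‖ = 1) (hay : ‖a y‖ = μ) :
    ∃ v ∈ W, v ≠ 0 ∧ ∃ s : ℝ, s ^ 2 = 1 ∧ a v = ((s * μ : ℝ) : ℂ) • v := by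
  have hmove : ∀ u w, inner ℂ (a u) w = inner ℂ u (a w) := fun u w => by
    rw [← ContinuousLinearMap.adjoint_inner_right, ← ContinuousLinearMap.star_eq_adjoint, ha.star_eq]
  have h2 : a (a y) = ((μ ^ 2 : ℝ) : ℂ) • y := by
    have h3 : ‖a (a y)‖ ≤ μ ^ 2 := by
      have := hmax _ (hW _ hy)
      rwa [hay, ← sq] at this
    -- Expanding the square gives `‖a (a y)‖² - 2 μ² ‖a y‖² + μ⁴`, at most `μ⁴ - 2 μ⁴ + μ⁴`.
    have h5 : ‖a (a y) - ((μ ^ 2 : ℝ) : ℂ) • y‖ ^ 2 ≤ 0 := by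
      rw [@norm_sub_sq ℂ, inner_smul_right, hmove, hmove, ← hmove y (a y), inner_self_eq_norm_sq_to_K,
        hay, norm_smul, hy1, Complex.norm_real, Real.norm_eq_abs, mul_one, sq_abs]
      have : RCLike.re (((μ ^ 2 : ℝ) : ℂ) * ((μ : ℂ)) ^ 2) = μ ^ 4 := by
        rw [← Complex.ofReal_pow, ← Complex.ofReal_mul]
        simp only [RCLike.re_to_complex, Complex.ofReal_re]
        ring
      erw [this]
      have h0 := norm_nonneg (a (a y))
      nlinarith [pow_le_pow_left₀ h0 h3 2]
    have := pow_eq_zero_iff (two_ne_zero) |>.mp (le_antisymm h5 (sq_nonneg _))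
    exact sub_eq_zero.mp (norm_eq_zero.mp this)
  -- Since `(a - μ) (a + μ) y = 0`, either `y` already has eigenvalue `-μ` or `a y + μ y` has
  -- eigenvalue `μ`.
  by_cases hv : a y + (μ : ℂ) • y = 0
  · refine ⟨y, hy, fun h0 => by simp [h0] at hy1, -1, by norm_num, ?_⟩
    rw [eq_neg_of_add_eq_zero_left hv]
    push_cast
    module
  · refine ⟨_, W.add_mem (hW _ hy) (W.smul_mem _ hy), hv, 1, by norm_num, ?_⟩
    rw [map_add, map_smul, h2]
    push_cast
    module

/-- On a nontrivial isotypic piece of the Casimir operator, its eigenvalue dominates the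
largest weight. -/
theorem IsPauliFamily.exists_weight_bound [FiniteDimensional ℂ V] [Fintype J] (H : IsPauliFamily h op b) {z : J} (hz : h z = 0) {A : ℝ}
    (hA : ∀ r, r ≠ z → ∑ t, b r t ^ 2 = A)
    {W : Submodule ℂ V} (hW : ∀ t, ∀ y ∈ W, h t y ∈ W) {c : ℝ}
    (hc : ∀ y ∈ W, ∑ t, ‖h t y‖ ^ 2 = c * ‖y‖ ^ 2) {x : V} (hx : x ∈ W) {t₀ : J}
    (hx0 : h t₀ x ≠ 0) :
    ∃ μ : ℝ, 0 < μ ∧ (∃ r, μ ≤ ‖h r‖) ∧ (∀ t, ∀ y ∈ W, ‖h t y‖ ≤ μ * ‖y‖) ∧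
      μ ^ 2 + μ * A ≤ c := by
  have hxne : x ≠ 0 := by rintro rfl; simp at hx0
  have hxn : ‖x‖ ≠ 0 := norm_ne_zero_iff.mpr hxne
  have hS : IsCompact ((W : Set V) ∩ Metric.sphere 0 1) :=
    (isCompact_sphere 0 1).inter_left W.closed_of_finiteDimensional
  have hunit : ∀ y ∈ W, y ≠ 0 → ((‖y‖⁻¹ : ℝ) : ℂ) • y ∈ (W : Set V) ∩ Metric.sphere 0 1 := by
    intro y hy hy0
    refine ⟨W.smul_mem _ hy, ?_⟩
    rw [mem_sphere_zero_iff_norm, norm_smul, Complex.norm_real, norm_inv, norm_norm,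
      inv_mul_cancel₀ (norm_ne_zero_iff.mpr hy0)]
  have hex : ∀ t, ∃ y ∈ (W : Set V) ∩ Metric.sphere 0 1,
      IsMaxOn (fun y => ‖h t y‖) ((W : Set V) ∩ Metric.sphere 0 1) y := fun t =>
    hS.exists_isMaxOn ⟨_, hunit x hx hxne⟩ (by fun_prop)
  choose y hyS hymax using hex
  have : Nonempty J := ⟨z⟩
  -- The maximum is taken over all indices at once, so that a single `μ` bounds every `h t` on `W`
  -- and is attained at `r`.
  obtain ⟨r, hr⟩ := Finite.exists_max fun t => ‖h t (y t)‖
  have hbound : ∀ t, ∀ w ∈ W, ‖h t w‖ ≤ ‖h r (y r)‖ * ‖w‖ := by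
    intro t w hw
    by_cases hw0 : w = 0
    · simp [hw0]
    · have h1 := (hymax t (hunit w hw hw0)).trans (hr t)
      simp only [map_smul, norm_smul, Complex.norm_real, norm_inv, norm_norm] at h1
      have h2 : 0 < ‖w‖ := norm_pos_iff.mpr hw0
      rwa [inv_mul_le_iff₀ h2, mul_comm] at h1
  have hpos : 0 < ‖h r (y r)‖ := by
    have h1 := hbound t₀ x hx
    have h2 : 0 < ‖h t₀ x‖ := norm_pos_iff.mpr hx0
    by_contra h3
    nlinarith [norm_nonneg x]
  have hy1 : ‖y r‖ = 1 := mem_sphere_zero_iff_norm.mp (hyS r).2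
  refine ⟨_, hpos, ⟨r, by simpa [hy1] using (h r).le_opNorm (y r)⟩, hbound, ?_⟩
  obtain ⟨v, hvW, hv0, s, hs, hv⟩ := exists_eigenvector_of_norm_le (H.selfAdjoint r) (hW r)
    (hbound r) (hyS r).1 hy1 rfl
  have h5 := H.le_sum_norm_sq hW hpos hs (hbound r) hvW hv
  have hrz : r ≠ z := by rintro rfl; simp [hz] at hpos
  rw [hA r hrz, hc v hvW] at h5
  have : 0 < ‖v‖ := norm_pos_iff.mpr hv0
  exact le_of_mul_le_mul_right h5 (by positivity)

theorem commute_starProjection_of_mapsTo {a : V →L[ℂ] V} (ha : IsSelfAdjoint a) {U : Submodule ℂ V}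
    [U.HasOrthogonalProjection] (hU : ∀ u ∈ U, a u ∈ U) : Commute a U.starProjection := by
  ext u
  refine (Submodule.eq_starProjection_of_mem_of_inner_eq_zero
    (hU _ (U.starProjection_apply_mem u)) fun w hw => ?_).symm
  change inner ℂ (a u - a (U.starProjection u)) w = 0
  rw [← map_sub, ← ContinuousLinearMap.adjoint_inner_right, ← ContinuousLinearMap.star_eq_adjoint,
    ha.star_eq]
  exact U.starProjection_inner_eq_zero u _ (hU w hw)

/-- A self-adjoint operator on a nonzero space has an eigenvalue of modulus its norm. -/
theorem exists_eigenvalue_norm_eq [FiniteDimensional ℂ V] [Nontrivial V] {T : V →L[ℂ] V}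
    (hT : IsSelfAdjoint T) : ∃ z : ℂ, ‖z‖ = ‖T‖ ∧ ∃ x, x ≠ 0 ∧ T x = z • x := by
  obtain ⟨z, hz, hzn⟩ := spectrum.exists_nnnorm_eq_spectralRadius T
  rw [hT.spectralRadius_eq_nnnorm] at hzn
  refine ⟨z, by exact congrArg NNReal.toReal (ENNReal.coe_injective hzn), ?_⟩
  have h1 : ¬ Function.Injective (algebraMap ℂ (V →L[ℂ] V) z - T) := by
    intro hinj
    refine hz ?_
    have h2 : IsUnit ((algebraMap ℂ (V →L[ℂ] V) z - T : V →L[ℂ] V) : V →ₗ[ℂ] V) :=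
      (Module.End.isUnit_iff _).mpr ⟨hinj, LinearMap.injective_iff_surjective.mp hinj⟩
    obtain ⟨u, hu⟩ := h2
    refine ⟨⟨_, LinearMap.toContinuousLinearMap (↑u⁻¹ : V →ₗ[ℂ] V), ?_, ?_⟩, rfl⟩
    · ext x
      have := congrArg (fun f : V →ₗ[ℂ] V => f x) u.mul_inv
      rw [hu] at this
      exact this
    · ext x
      have := congrArg (fun f : V →ₗ[ℂ] V => f x) u.inv_mul
      rw [hu] at this
      exact this
  rw [injective_iff_map_eq_zero] at h1
  push Not at h1
  obtain ⟨x, hx, hx0⟩ := h1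
  refine ⟨x, hx0, (sub_eq_zero.mp ?_).symm⟩
  simpa [Algebra.algebraMap_eq_smul_one] using hx

/-- The index `z` stands for the identity string, where the generator is zero; it is kept so that
`op` acts on all of `J`, and left out of the mean. The condition on `g` says `g ≤ (1 + A / K) / m`
when `K > 0`. -/
theorem IsPauliFamily.norm_mean_sub_le [FiniteDimensional ℂ V] [Fintype J] [DecidableEq J]
    (H : IsPauliFamily h op b) {z : J} (hz : h z = 0) {A : ℝ} (hA0 : 0 ≤ A)
    (hA : ∀ r, r ≠ z → ∑ t, b r t ^ 2 = A) {m K g : ℝ} (hm : ((Finset.univ.erase z).card : ℝ) = m)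
    (hm0 : 0 < m) (hK : ∀ t, ‖h t‖ ≤ K) (hg1 : g ≤ 1) (hg : g * m * K ≤ K + A) :
    ‖m⁻¹ • ∑ t ∈ Finset.univ.erase z, ((h t).ker).starProjection -
      (⨅ t, (h t).ker).starProjection‖ ≤ 1 - g := by
  have : Nonempty J := ⟨z⟩
  set P : J → V →L[ℂ] V := fun t => ((h t).ker).starProjection with hP
  set Q : V →L[ℂ] V := (⨅ t, (h t).ker).starProjection with hQ
  set M : V →L[ℂ] V := m⁻¹ • ∑ t ∈ Finset.univ.erase z, P t with hM
  set C : V →L[ℂ] V := ∑ t, h t * h t with hC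
  have hCsa : IsSelfAdjoint C := by
    refine isSelfAdjoint_sum _ fun t _ => ?_
    simpa [(H.selfAdjoint t).star_eq] using! IsSelfAdjoint.mul_star_self (h t)
  have hCh : ∀ r, Commute (h r) C := H.commute_casimir
  have hCapp : ∀ r y, h r (C y) = C (h r y) := fun r y =>
    congrArg (fun f : V →L[ℂ] V => f y) (hCh r).eq
  have hCP : ∀ t, Commute C (P t) := fun t =>
    commute_starProjection_of_mapsTo hCsa fun u hu => by
      have hu : h t u = 0 := hu
      change h t (C u) = 0
      rw [hCapp, hu, map_zero]
  have hCQ : Commute C Q := commute_starProjection_of_mapsTo hCsa fun u hu => by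
    rw [Submodule.mem_iInf] at hu ⊢
    intro t
    have hu : h t u = 0 := hu t
    change h t (C u) = 0
    rw [hCapp, hu, map_zero]
  have hMsa : IsSelfAdjoint M :=
    IsSelfAdjoint.smul (IsSelfAdjoint.all _)
      (isSelfAdjoint_sum _ fun t _ => isSelfAdjoint_starProjection _)
  have hTsa : IsSelfAdjoint (M - Q) := hMsa.sub (isSelfAdjoint_starProjection _)
  have hTC : Commute (M - Q) C :=
    ((Commute.sum_left _ _ _ fun t _ => (hCP t).symm).smul_left _).sub_left hCQ.symm
  rcases subsingleton_or_nontrivial V with hV | hV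
  · rw [Subsingleton.elim (M - Q) 0, norm_zero]
    linarith
  obtain ⟨w, hw, x, hx0, hx⟩ := exists_eigenvalue_norm_eq hTsa
  rw [← hw]
  by_cases hw0 : w = 0
  · rw [hw0, norm_zero]; linarith
  obtain ⟨x, hx0, hx, c, hcx⟩ := exists_joint_eigenvector hTC hx0 hx
  have hPQ : ∀ t, Q * P t = Q := fun t => by
    ext y
    exact congrArg (fun f : V →L[ℂ] V => f y)
      (Submodule.starProjection_comp_starProjection_of_le (iInf_le _ t))
  -- Hence an eigenvector for a nonzero eigenvalue is orthogonal to the joint kernel, and some `h t`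
  -- does not kill it.
  have hQT : Q * (M - Q) = 0 := by
    rw [mul_sub, hM, mul_smul_comm, Finset.mul_sum, Finset.sum_congr rfl fun t _ => hPQ t,
      Finset.sum_const, ← Nat.cast_smul_eq_nsmul ℝ, hm, smul_smul, inv_mul_cancel₀ hm0.ne', one_smul,
      (Submodule.isIdempotentElem_starProjection _).eq, sub_self]
  have hQx : Q x = 0 := by
    have h1 : Q ((M - Q) x) = 0 := congrArg (fun f : V →L[ℂ] V => f x) hQT
    rw [hx, map_smul] at h1
    exact (smul_eq_zero.mp h1).resolve_left hw0
  have hMx : M x = w • x := by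
    rw [← hx, sub_apply, hQx, sub_zero]
  let W : Submodule ℂ V := Module.End.eigenspace (C : V →ₗ[ℂ] V) c
  have hWmem : ∀ y, y ∈ W ↔ C y = c • y := fun y => Module.End.mem_eigenspace_iff
  have hinv : ∀ a : V →L[ℂ] V, Commute C a → ∀ y ∈ W, a y ∈ W := by
    intro a ha y hy
    rw [hWmem] at hy ⊢
    have : C (a y) = a (C y) := congrArg (fun f : V →L[ℂ] V => f y) ha.eq
    rw [this, hy, map_smul]
  have hsum : ∀ y ∈ W, ∑ t, ‖h t y‖ ^ 2 = c.re * ‖y‖ ^ 2 := by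
    intro y hy
    have h1 := inner_casimir_eq_sum_norm_sq H.selfAdjoint y
    rw [← hC, (hWmem y).mp hy, inner_smul_right, inner_self_eq_norm_sq_to_K] at h1
    have h2 := congrArg Complex.re h1
    rw [Complex.ofReal_re] at h2
    rw [← h2, ← Complex.re_mul_ofReal]
    push_cast
    rfl
  have hxW : x ∈ W := (hWmem x).mpr hcx
  have hex : ∃ t, h t x ≠ 0 := by
    by_contra! hall
    have : x ∈ ⨅ t, (h t).ker := (Submodule.mem_iInf _).mpr fun t => hall t
    exact hx0 ((Submodule.starProjection_eq_self_iff.mpr this).symm.trans hQx)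
  obtain ⟨t₀, ht₀⟩ := hex
  obtain ⟨μ, hμ0, ⟨r, hr⟩, hμ, hcμ⟩ := H.exists_weight_bound hz hA
    (fun t => hinv _ (hCh t).symm) hsum hxW ht₀
  have hμK : μ ≤ K := hr.trans (hK r)
  -- Pythagoras: `h t` only sees the component `x - P t x`, which stays in `W` because `P t`
  -- commutes with `C`.
  have hPx : ∀ t, ‖P t x‖ ^ 2 ≤ ‖x‖ ^ 2 - ‖h t x‖ ^ 2 / μ ^ 2 := by
    intro t
    have h1 := Submodule.norm_sq_eq_add_norm_sq_starProjection x ((h t).ker)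
    rw [Submodule.starProjection_orthogonal_val] at h1
    have h2 : h t (P t x) = 0 := Submodule.starProjection_apply_mem ((h t).ker) x
    have h3 := hμ t (x - P t x) (W.sub_mem hxW (hinv _ (hCP t) x hxW))
    rw [map_sub, h2, sub_zero] at h3
    have h4 : ‖h t x‖ ^ 2 / μ ^ 2 ≤ ‖x - P t x‖ ^ 2 := by
      rw [div_le_iff₀ (by positivity), ← mul_pow, mul_comm]
      exact pow_le_pow_left₀ (norm_nonneg _) h3 2
    linarith
  have hR : ‖w‖ * ‖x‖ ^ 2 = m⁻¹ * ∑ t ∈ Finset.univ.erase z, ‖P t x‖ ^ 2 := by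
    have h1 : inner ℂ x (M x) =
        ((m⁻¹ * ∑ t ∈ Finset.univ.erase z, ‖P t x‖ ^ 2 : ℝ) : ℂ) := by
      rw [hM, smul_apply, sum_apply, inner_smul_right_eq_smul, inner_sum,
        Finset.sum_congr rfl fun t _ => inner_starProjection_self ((h t).ker) x]
      push_cast
      rw [Complex.real_smul]
      push_cast
      rfl
    rw [hMx, inner_smul_right, inner_self_eq_norm_sq_to_K] at h1
    have h2 := congrArg norm h1
    rw [norm_mul, Complex.norm_real, Real.norm_of_nonneg (by positivity)] at h2
    rw [← h2]
    simp
  have hsum2 : ∑ t ∈ Finset.univ.erase z, ‖h t x‖ ^ 2 = c.re * ‖x‖ ^ 2 := by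
    rw [← hsum x hxW, ← Finset.add_sum_erase _ _ (Finset.mem_univ z), hz]
    simp
  have hle : ∑ t ∈ Finset.univ.erase z, ‖P t x‖ ^ 2 ≤ m * ‖x‖ ^ 2 - c.re * ‖x‖ ^ 2 / μ ^ 2 := by
    refine (Finset.sum_le_sum fun t _ => hPx t).trans_eq ?_
    rw [Finset.sum_sub_distrib, Finset.sum_const, nsmul_eq_mul, hm, ← Finset.sum_div, hsum2]
  have hxpos : 0 < ‖x‖ ^ 2 := by have := norm_pos_iff.mpr hx0; positivity
  -- `(μ + A) / μ` decreases in `μ`, so the hypothesis at `K` passes to `μ ≤ K`.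
  have hcg : g * m ≤ c.re / μ ^ 2 := by
    have h1 : g * m * μ ≤ μ + A := by
      have hKpos : 0 < K := hμ0.trans_le hμK
      rcases le_or_gt (g * m) 1 with h | h
      · nlinarith
      · nlinarith
    rw [le_div_iff₀ (by positivity)]
    nlinarith
  have : ‖w‖ * ‖x‖ ^ 2 ≤ (1 - g) * ‖x‖ ^ 2 := by
    rw [hR, inv_mul_le_iff₀ hm0]
    refine hle.trans ?_
    have h2 : g * m * ‖x‖ ^ 2 ≤ c.re / μ ^ 2 * ‖x‖ ^ 2 := by gcongr
    have h3 : c.re / μ ^ 2 * ‖x‖ ^ 2 = c.re * ‖x‖ ^ 2 / μ ^ 2 := by ring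
    linarith
  exact le_of_mul_le_mul_right this hxpos

end CasimirGap

/-! ### One-parameter unitary groups and the Lie–Trotter formula. -/

section OneParameter

open Filter Topology

/-- A continuous one-parameter semigroup in a Banach algebra is an exponential. -/
theorem exists_exp_generator {B : Type*} [NormedRing B] [NormedAlgebra ℝ B] [CompleteSpace B]
    {u : ℝ → B} (hu : Continuous u) (h0 : u 0 = 1) (hadd : ∀ s t, u (s + t) = u s * u t) :
    ∃ a : B, ∀ t : ℝ, u t = NormedSpace.exp (t • a) := by
  let _ : NormedAlgebra ℚ B := .restrictScalars ℚ ℝ B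
  have hint : ∀ s t, IntervalIntegrable u volume s t := fun s t => hu.intervalIntegrable s t
  have hder : ∀ t, HasDerivAt (fun t => ∫ s in (0 : ℝ)..t, u s) (u t) t := fun t =>
    intervalIntegral.integral_hasDerivAt_right (hint 0 t)
      (hu.stronglyMeasurableAtFilter _ _) hu.continuousAt
  -- For small `ε` the mean of `u` over `[0, ε]` is close to `1`, hence invertible. Dividing by it
  -- writes `u t` as a difference of integrals of a continuous function, so `u` is differentiable.
  obtain ⟨ε, hε, hunit⟩ : ∃ ε : ℝ, ε ≠ 0 ∧ IsUnit (ε⁻¹ • ∫ s in (0 : ℝ)..ε, u s) := by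
    have h1 := (hasDerivAt_iff_tendsto_slope_zero.mp (hder 0))
    simp only [zero_add, intervalIntegral.integral_same, sub_zero, h0] at h1
    have h2 : {x : B | IsUnit x} ∈ 𝓝 (1 : B) := Units.isOpen.mem_nhds isUnit_one
    obtain ⟨ε, hε1, hε2⟩ := ((h1.eventually h2).and self_mem_nhdsWithin).exists
    exact ⟨ε, hε2, hε1⟩
  obtain ⟨J, hJ⟩ := hunit
  have hJu : ∀ t, u t * J = ε⁻¹ • ((∫ s in (0 : ℝ)..t + ε, u s) - ∫ s in (0 : ℝ)..t, u s) := by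
    intro t
    rw [hJ, mul_smul_comm, intervalIntegral.integral_interval_sub_left (hint _ _) (hint _ _)]
    congr 1
    have h1 := ((ContinuousLinearMap.mul ℝ B) (u t)).intervalIntegral_comp_comm (hint 0 ε)
    simp only [ContinuousLinearMap.mul_apply'] at h1
    rw [← h1]
    simp_rw [← hadd]
    rw [intervalIntegral.integral_comp_add_left (fun s => u s) t, add_zero]
  have hueq : u = fun t =>
      ε⁻¹ • ((∫ s in (0 : ℝ)..t + ε, u s) - ∫ s in (0 : ℝ)..t, u s) * (↑J⁻¹ : B) := by
    funext t
    rw [← hJu, Units.mul_inv_cancel_right]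
  obtain ⟨a, ha⟩ : ∃ a, HasDerivAt u a 0 := by
    rw [hueq]
    exact ⟨_, ((((hder _).comp_add_const 0 ε).sub (hder 0)).const_smul ε⁻¹).mul_const _⟩
  have hudiff : ∀ t, HasDerivAt u (u t * a) t := by
    intro t
    have h1 : HasDerivAt (fun s => u t * u (s - t)) (u t * a) t := by
      have h2 : HasDerivAt u a (t - t) := by rwa [sub_self]
      exact (h2.comp_sub_const t t).const_mul (u t)
    convert h1 using 2 with s
    rw [← hadd]; congr 1; ring
  refine ⟨a, fun t => ?_⟩
  have hw : ∀ t, HasDerivAt (fun t => u t * NormedSpace.exp ((-t) • a)) 0 t := by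
    intro t
    have h1 := (hasDerivAt_exp_smul_const' (𝕂 := ℝ) a (-t)).scomp t (hasDerivAt_neg t)
    have h2 := (hudiff t).mul h1
    refine h2.congr_deriv ?_
    simp only [Function.comp_apply, neg_smul, one_smul]
    noncomm_ring
  have hc := is_const_of_deriv_eq_zero (fun t => (hw t).differentiableAt) (fun t => (hw t).deriv) t 0
  simp only [h0, neg_zero, zero_smul, NormedSpace.exp_zero, mul_one] at hc
  have hinv : NormedSpace.exp ((-t) • a) * NormedSpace.exp (t • a) = 1 := by
    rw [← NormedSpace.exp_add_of_commute, ← add_smul, neg_add_cancel, zero_smul,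
      NormedSpace.exp_zero]
    exact ((Commute.refl a).smul_left _).smul_right _
  calc u t = u t * NormedSpace.exp ((-t) • a) * NormedSpace.exp (t • a) := by
        rw [mul_assoc, hinv, mul_one]
    _ = _ := by rw [hc, one_mul]

variable {A : Type*} [CStarAlgebra A]

/-- The one-parameter group `θ ↦ exp (i θ a)`. -/
def expI (a : A) (θ : ℝ) : A := NormedSpace.exp ((Complex.I * (θ : ℂ)) • a)

theorem expI_eq_exp_smul (a : A) (θ : ℝ) :
    expI a θ = NormedSpace.exp (θ • ((Complex.I : ℂ) • a)) := by
  rw [expI, mul_comm, mul_smul]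
  rfl

theorem expI_zero (a : A) : expI a 0 = 1 := by simp [expI]

theorem expI_add (a : A) (s t : ℝ) : expI a (s + t) = expI a s * expI a t := by
  let _ : NormedAlgebra ℚ A := .restrictScalars ℚ ℝ A
  rw [expI_eq_exp_smul, expI_eq_exp_smul, expI_eq_exp_smul, add_smul,
    NormedSpace.exp_add_of_commute]
  exact ((Commute.refl _).smul_left _).smul_right _

theorem hasDerivAt_expI (a : A) (θ : ℝ) :
    HasDerivAt (expI a) (expI a θ * ((Complex.I : ℂ) • a)) θ := by
  have h := hasDerivAt_exp_smul_const (𝕂 := ℝ) ((Complex.I : ℂ) • a) θ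
  rw [← expI_eq_exp_smul] at h
  exact h.congr_of_eventuallyEq (Eventually.of_forall fun s => expI_eq_exp_smul a s)

theorem continuous_expI (a : A) : Continuous (expI a) :=
  continuous_iff_continuousAt.mpr fun θ => (hasDerivAt_expI a θ).continuousAt

theorem commute_expI (a : A) (θ : ℝ) : Commute a (expI a θ) :=
  ((Commute.refl a).smul_right _).exp_right

theorem hasDerivAt_expI' (a : A) (θ : ℝ) :
    HasDerivAt (expI a) (((Complex.I : ℂ) • a) * expI a θ) θ := by
  have := hasDerivAt_expI a θ
  rwa [mul_smul_comm, ← (commute_expI a θ).eq, ← smul_mul_assoc] at this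

theorem hasDerivAt_expI_zero (a : A) : HasDerivAt (expI a) ((Complex.I : ℂ) • a) 0 := by
  have := hasDerivAt_expI a 0
  rwa [expI_zero, one_mul] at this

theorem expI_injective {a b : A} (h : ∀ θ, expI a θ = expI b θ) : a = b := by
  have h1 := hasDerivAt_expI_zero b
  rw [← funext h] at h1
  exact smul_right_injective A Complex.I_ne_zero ((hasDerivAt_expI_zero a).unique h1)

theorem expI_mem_unitary {a : A} (ha : IsSelfAdjoint a) (θ : ℝ) : expI a θ ∈ unitary A := by
  have h : star (expI a θ) = expI a (-θ) := by
    rw [expI, expI, NormedSpace.star_exp, star_smul, ha.star_eq]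
    congr 2
    simp
  rw [Unitary.mem_iff, h, ← expI_add, ← expI_add, neg_add_cancel, add_neg_cancel, expI_zero]
  exact ⟨rfl, rfl⟩

theorem norm_le_one_of_mem_unitary {a : A} (ha : a ∈ unitary A) : ‖a‖ ≤ 1 := by
  rcases subsingleton_or_nontrivial A with h | h
  · rw [Subsingleton.elim a 0, norm_zero]; exact zero_le_one
  · exact (CStarRing.norm_of_mem_unitary ha).le

theorem norm_pow_sub_pow_le {u v : A} (hu : ‖u‖ ≤ 1) (hv : v ∈ unitary A) (n : ℕ) :
    ‖u ^ n - v ^ n‖ ≤ n * ‖u - v‖ := by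
  induction n with
  | zero => simp
  | succ n ih =>
    have h1 : u ^ (n + 1) - v ^ (n + 1) = u * (u ^ n - v ^ n) + (u - v) * v ^ n := by
      rw [pow_succ', pow_succ']; noncomm_ring
    rw [h1]
    have h2 : ‖v ^ n‖ ≤ 1 := norm_le_one_of_mem_unitary (pow_mem hv n)
    have h3 : ‖u * (u ^ n - v ^ n)‖ ≤ n * ‖u - v‖ := (norm_mul_le _ _).trans (by
      nlinarith [norm_nonneg (u ^ n - v ^ n)])
    have h4 : ‖(u - v) * v ^ n‖ ≤ ‖u - v‖ := (norm_mul_le _ _).trans (by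
      nlinarith [norm_nonneg (u - v)])
    push_cast
    linarith [norm_add_le (u * (u ^ n - v ^ n)) ((u - v) * v ^ n)]

theorem expI_div_pow (a : A) (θ : ℝ) {n : ℕ} (hn : n ≠ 0) : expI a (θ / n) ^ n = expI a θ := by
  have h : ∀ (s : ℝ) (k : ℕ), expI a s ^ k = expI a (k * s) := by
    intro s k
    induction k with
    | zero => simp [expI_zero]
    | succ k ih => rw [pow_succ, ih, ← expI_add]; congr 1; push_cast; ring
  rw [h]
  congr 1
  field_simp

/-- The Lie–Trotter product formula for unitary one-parameter groups. -/
theorem tendsto_trotter {a b : A} (ha : IsSelfAdjoint a) (hb : IsSelfAdjoint b) (θ : ℝ) :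
    Tendsto (fun n : ℕ => (expI a (θ / n) * expI b (θ / n)) ^ n) atTop (𝓝 (expI (a + b) θ)) := by
  -- The one-step error `f` vanishes to first order at `0`, so `n` steps of length `θ / n`
  -- accumulate an error `n * o(1 / n)`.
  set f : ℝ → A := fun s => expI a s * expI b s - expI (a + b) s with hf
  have hf0 : f 0 = 0 := by simp [hf, expI_zero]
  have hfd : HasDerivAt f 0 0 := by
    have := ((hasDerivAt_expI_zero a).mul (hasDerivAt_expI_zero b)).sub
      (hasDerivAt_expI_zero (a + b))
    refine this.congr_deriv ?_
    rw [expI_zero, expI_zero, smul_add]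
    simp
  have hlim : Tendsto (fun n : ℕ => (n : ℝ) * ‖f (θ / n)‖) atTop (𝓝 0) := by
    have h1 := (hasDerivAt_iff_isLittleO.mp hfd)
    simp only [hf0, sub_zero, smul_zero] at h1
    have h2 : Tendsto (fun n : ℕ => θ / (n : ℝ)) atTop (𝓝 0) :=
      tendsto_const_div_atTop_nhds_zero_nat θ
    have h3 := h1.comp_tendsto h2
    have h4 : (fun n : ℕ => (n : ℝ) * ‖f (θ / n)‖) =o[atTop] fun _ : ℕ => (1 : ℝ) := by
      have h5 := (Asymptotics.isBigO_refl (fun n : ℕ => (n : ℝ)) atTop).mul_isLittleO h3.norm_left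
      refine h5.trans_isBigO ?_
      refine Asymptotics.IsBigO.of_bound |θ| ?_
      filter_upwards [eventually_gt_atTop 0] with n hn
      have : (n : ℝ) ≠ 0 := by positivity
      simp only [Function.comp_apply, norm_one, mul_one]
      rw [mul_div_cancel₀ θ this, Real.norm_eq_abs]
    exact (Asymptotics.isLittleO_one_iff ℝ).mp h4
  rw [tendsto_iff_norm_sub_tendsto_zero]
  refine squeeze_zero' (Eventually.of_forall fun _ => norm_nonneg _) ?_ hlim
  filter_upwards [eventually_gt_atTop 0] with n hn
  rw [← expI_div_pow (a + b) θ hn.ne']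
  exact norm_pow_sub_pow_le (norm_le_one_of_mem_unitary
    (mul_mem (expI_mem_unitary ha _) (expI_mem_unitary hb _))) (expI_mem_unitary (ha.add hb) _) n

/-- A norm-continuous one-parameter group of unitaries is `θ ↦ exp (i θ a)` with `a` self-adjoint. -/
theorem exists_selfAdjoint_generator {u : ℝ → A} (hu : Continuous u) (h0 : u 0 = 1)
    (hadd : ∀ s t, u (s + t) = u s * u t) (hun : ∀ t, u t ∈ unitary A) :
    ∃ a : A, IsSelfAdjoint a ∧ ∀ t, u t = expI a t := by
  obtain ⟨a, ha⟩ := exists_exp_generator hu h0 hadd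
  have hstar : ∀ t, star (u t) = u (-t) := by
    intro t
    have h1 : u t * u (-t) = 1 := by rw [← hadd, add_neg_cancel, h0]
    calc star (u t) = star (u t) * (u t * u (-t)) := by rw [h1, mul_one]
      _ = u (-t) := by rw [← mul_assoc, (Unitary.mem_iff.mp (hun t)).1, one_mul]
  have hd : HasDerivAt u a 0 := by
    have := hasDerivAt_exp_smul_const (𝕂 := ℝ) a 0
    rw [zero_smul, NormedSpace.exp_zero, one_mul] at this
    exact this.congr_of_eventuallyEq (Eventually.of_forall ha)
  -- Unitarity gives `star (u t) = u (-t)`; both sides are differentiated at `0`.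
  have hsa : star a = -a := by
    have h1 : HasDerivAt (fun t => star (u t)) (star a) 0 := hd.star
    have h2 : HasDerivAt (fun t => u (-t)) (-a) 0 := by
      have h3 : HasDerivAt u a (-0) := by rwa [neg_zero]
      exact (h3.scomp (0 : ℝ) (hasDerivAt_neg (0 : ℝ))).congr_deriv (by simp)
    rw [funext hstar] at h1
    exact h1.unique h2
  refine ⟨(-Complex.I) • a, ?_, fun t => ?_⟩
  · rw [IsSelfAdjoint, star_smul, hsa]
    simp
  · rw [ha, expI_eq_exp_smul, smul_smul]
    simp

end OneParameter

/-! ### The derived representation of the Lie algebra of `SU`. -/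

section LieAlgebra

open Filter Topology

variable {A : Type*} [CStarAlgebra A]

theorem star_expI {a : A} (ha : IsSelfAdjoint a) (θ : ℝ) : star (expI a θ) = expI a (-θ) := by
  rw [expI, expI, NormedSpace.star_exp, star_smul, ha.star_eq]
  congr 2
  simp

theorem expI_smul (a : A) (c θ : ℝ) : expI (c • a) θ = expI a (c * θ) := by
  rw [expI_eq_exp_smul, expI_eq_exp_smul, mul_comm, mul_smul, smul_comm c]

theorem expI_conj {u : A} (hu : u ∈ unitary A) (a : A) (θ : ℝ) :
    expI (u * a * star u) θ = u * expI a θ * star u := by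
  let _ : NormedAlgebra ℚ A := .restrictScalars ℚ ℝ A
  have := NormedSpace.exp_units_conj (Unitary.toUnits ⟨u, hu⟩) ((Complex.I * (θ : ℂ)) • a)
  rw [expI, expI, ← smul_mul_assoc, ← mul_smul_comm]
  exact this

theorem expI_mul_of_commute {a b : A} (h : Commute a b) (θ : ℝ) :
    expI (a + b) θ = expI a θ * expI b θ := by
  let _ : NormedAlgebra ℚ A := .restrictScalars ℚ ℝ A
  rw [expI, smul_add, NormedSpace.exp_add_of_commute]
  · rfl
  · exact (h.smul_left _).smul_right _

theorem expI_algebraMap (c : ℝ) (θ : ℝ) :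
    expI (algebraMap ℂ A c) θ = algebraMap ℂ A (Complex.exp (Complex.I * (c * θ : ℝ))) := by
  let _ : NormedAlgebra ℚ A := .restrictScalars ℚ ℝ A
  rw [expI, Algebra.smul_def, ← map_mul, Complex.exp_eq_exp_ℂ,
    NormedSpace.algebraMap_exp_comm]
  congr 2
  push_cast
  ring

variable {ι : Type*} [Fintype ι] [DecidableEq ι] {B : Type*} [CStarAlgebra B]

/-- The one-parameter subgroup of `SU` generated by a traceless Hermitian matrix. -/
def suExp {X : Matrix ι ι ℂ} (hX : X.IsHermitian) (htr : X.trace = 0) (θ : ℝ) :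
    Matrix.specialUnitaryGroup ι ℂ :=
  ⟨expI X θ, exp_mem_specialUnitaryGroup hX htr θ⟩

/-- `a` generates the one-parameter group `θ ↦ ρ (exp (i θ X))`. -/
structure IsGenerator (ρ : Matrix.specialUnitaryGroup ι ℂ →* unitary B) (X : Matrix ι ι ℂ) (a : B) :
    Prop where
  selfAdjoint : IsSelfAdjoint a
  map_eq : ∀ (θ : ℝ) (U : Matrix.specialUnitaryGroup ι ℂ), U.1 = expI X θ → (ρ U : B) = expI a θ

variable {ρ : Matrix.specialUnitaryGroup ι ℂ →* unitary B}

theorem exists_isGenerator (hρ : Continuous ρ) {X : Matrix ι ι ℂ} (hX : X.IsHermitian)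
    (htr : X.trace = 0) : ∃ a, IsGenerator ρ X a := by
  have hc : Continuous (suExp hX htr) := (continuous_expI X).subtype_mk _
  obtain ⟨a, ha, h⟩ := exists_selfAdjoint_generator
    (u := fun θ => (ρ (suExp hX htr θ) : B)) (continuous_subtype_val.comp (hρ.comp hc))
    (by
      have : suExp hX htr 0 = 1 := Subtype.ext (expI_zero X)
      simp [this])
    (fun s t => by
      have : suExp hX htr (s + t) = suExp hX htr s * suExp hX htr t := Subtype.ext (expI_add X s t)
      simp [this])
    (fun t => (ρ (suExp hX htr t)).2)
  refine ⟨a, ha, fun θ U hU => ?_⟩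
  rw [← h]
  exact congrArg (fun V => (ρ V : B)) (Subtype.ext hU)

theorem IsGenerator.unique {X : Matrix ι ι ℂ} (hX : X.IsHermitian) (htr : X.trace = 0) {a b : B}
    (ha : IsGenerator ρ X a) (hb : IsGenerator ρ X b) : a = b :=
  expI_injective fun θ => by
    rw [← ha.map_eq θ (suExp hX htr θ) rfl, hb.map_eq θ (suExp hX htr θ) rfl]

theorem IsGenerator.smul {X : Matrix ι ι ℂ} {a : B} (ha : IsGenerator ρ X a) (c : ℝ) :
    IsGenerator ρ (c • X) (c • a) := by
  refine ⟨(IsSelfAdjoint.all c).smul ha.selfAdjoint, fun θ U hU => ?_⟩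
  rw [expI_smul] at hU ⊢
  exact ha.map_eq _ U hU

/-- The Trotter products converge in the group and, after applying `ρ`, in `B`; continuity of `ρ`
identifies the two limits. -/
theorem IsGenerator.add (hρ : Continuous ρ) {X Y : Matrix ι ι ℂ} (hX : X.IsHermitian)
    (htrX : X.trace = 0) (hY : Y.IsHermitian) (htrY : Y.trace = 0) {a b : B}
    (ha : IsGenerator ρ X a) (hb : IsGenerator ρ Y b) : IsGenerator ρ (X + Y) (a + b) := by
  refine ⟨ha.selfAdjoint.add hb.selfAdjoint, fun θ U hU => ?_⟩
  let V : ℕ → Matrix.specialUnitaryGroup ι ℂ := fun n =>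
    (suExp hX htrX (θ / n) * suExp hY htrY (θ / n)) ^ n
  have hV : Tendsto V atTop (𝓝 U) := by
    rw [tendsto_subtype_rng, hU]
    exact tendsto_trotter (A := Matrix ι ι ℂ) hX hY θ
  have h1 : Tendsto (fun n => (ρ (V n) : B)) atTop (𝓝 (ρ U : B)) :=
    ((continuous_subtype_val.comp hρ).tendsto U).comp hV
  have h2 := tendsto_trotter ha.selfAdjoint hb.selfAdjoint θ
  refine tendsto_nhds_unique h1 (h2.congr fun n => ?_)
  simp only [V, map_pow, map_mul, SubmonoidClass.coe_pow, Submonoid.coe_mul]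
  rw [ha.map_eq _ _ rfl, hb.map_eq _ _ rfl]

theorem IsGenerator.conj {X : Matrix ι ι ℂ} {a : B} (ha : IsGenerator ρ X a)
    (U : Matrix.specialUnitaryGroup ι ℂ) :
    IsGenerator ρ (U.1 * X * star U.1) ((ρ U : B) * a * star (ρ U : B)) := by
  refine ⟨ha.selfAdjoint.conjugate _, fun θ V hV => ?_⟩
  have hUu : U.1 ∈ unitary (Matrix ι ι ℂ) := U.2.1
  rw [expI_conj hUu] at hV
  rw [expI_conj (ρ U).2]
  have hW : (U⁻¹ * V * U).1 = expI X θ := by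
    change star U.1 * V.1 * U.1 = _
    rw [hV]
    have h1 : star U.1 * U.1 = 1 := (Unitary.mem_iff.mp hUu).1
    calc star U.1 * (U.1 * expI X θ * star U.1) * U.1
        = (star U.1 * U.1) * expI X θ * (star U.1 * U.1) := by noncomm_ring
      _ = _ := by rw [h1, one_mul, mul_one]
  rw [← ha.map_eq θ _ hW, ← Unitary.coe_star, Unitary.star_eq_inv, ← map_inv, ← Submonoid.coe_mul,
    ← Submonoid.coe_mul, ← map_mul, ← map_mul]
  congr 3
  group

/-- The derived representation of the Lie algebra, extended linearly to all matrices. -/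
theorem exists_linear_generator (hρ : Continuous ρ) :
    ∃ L : Matrix ι ι ℂ →ₗ[ℝ] B, ∀ X : Matrix ι ι ℂ, X.IsHermitian → X.trace = 0 →
      IsGenerator ρ X (L X) := by
  let S : Submodule ℝ (Matrix ι ι ℂ) :=
    { carrier := {X | X.IsHermitian ∧ X.trace = 0}
      zero_mem' := ⟨Matrix.isHermitian_zero, Matrix.trace_zero ..⟩
      add_mem' := fun hX hY => ⟨hX.1.add hY.1, by rw [Matrix.trace_add, hX.2, hY.2, add_zero]⟩
      smul_mem' := fun c X hX => ⟨hX.1.smul (IsSelfAdjoint.all c),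
        by rw [Matrix.trace_smul, hX.2, smul_zero]⟩ }
  have hex : ∀ X : S, ∃ a, IsGenerator ρ X.1 a := fun X => exists_isGenerator hρ X.2.1 X.2.2
  choose g hg using hex
  let L₀ : S →ₗ[ℝ] B :=
    { toFun := g
      map_add' := fun X Y => (hg (X + Y)).unique (X + Y).2.1 (X + Y).2.2
        ((hg X).add hρ X.2.1 X.2.2 Y.2.1 Y.2.2 (hg Y))
      map_smul' := fun c X => (hg (c • X)).unique (c • X).2.1 (c • X).2.2 ((hg X).smul c) }
  -- The extension outside the traceless Hermitian matrices is arbitrary; in particular `L 1`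
  -- carries no information.
  obtain ⟨L, hL⟩ := L₀.exists_extend
  refine ⟨L, fun X hX htr => ?_⟩
  have : L X = g ⟨X, hX, htr⟩ := congrArg (fun f : S →ₗ[ℝ] B => f ⟨X, hX, htr⟩) hL
  rw [this]
  exact hg ⟨X, hX, htr⟩

theorem hasDerivAt_expI_conj (x y : A) :
    HasDerivAt (fun s => expI y s * x * expI y (-s)) (Complex.I • (y * x - x * y)) 0 := by
  have h1 : HasDerivAt (fun s => expI y (-s)) (-(Complex.I • y)) 0 := by
    have h3 : HasDerivAt (expI y) (Complex.I • y) (-0) := by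
      rw [neg_zero]; exact hasDerivAt_expI_zero y
    exact (h3.scomp (0 : ℝ) (hasDerivAt_neg (0 : ℝ))).congr_deriv (by simp)
  refine (((hasDerivAt_expI_zero y).mul_const x).mul h1).congr_deriv ?_
  simp only [neg_zero, expI_zero, one_mul, mul_one, smul_sub, smul_mul_assoc, mul_neg,
    mul_smul_comm]
  abel

/-- Conjugation by `exp (i s Y)` intertwines with `L` by uniqueness of generators; the derivative at
`s = 0` is the bracket relation. -/
theorem map_commutator {L : Matrix ι ι ℂ →ₗ[ℝ] B}
    (hL : ∀ X : Matrix ι ι ℂ, X.IsHermitian → X.trace = 0 → IsGenerator ρ X (L X))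
    {X Y : Matrix ι ι ℂ} (hX : X.IsHermitian) (htrX : X.trace = 0) (hY : Y.IsHermitian)
    (htrY : Y.trace = 0) :
    L (Complex.I • (Y * X - X * Y)) = Complex.I • (L Y * L X - L X * L Y) := by
  have hconj : ∀ s, L (expI Y s * X * expI Y (-s)) = expI (L Y) s * L X * expI (L Y) (-s) := by
    intro s
    have h1 := (hL X hX htrX).conj (suExp hY htrY s)
    have hstar : star (suExp hY htrY s).1 = expI Y (-s) := star_expI (A := Matrix ι ι ℂ) hY s
    have hu : expI Y (-s) * expI Y s = 1 := by rw [← expI_add, neg_add_cancel, expI_zero]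
    rw [hstar, (hL Y hY htrY).map_eq s _ rfl, star_expI (hL Y hY htrY).selfAdjoint] at h1
    change IsGenerator ρ (expI Y s * X * expI Y (-s)) _ at h1
    have hH : (expI Y s * X * expI Y (-s)).IsHermitian := by
      rw [← hstar]
      exact Matrix.isHermitian_mul_mul_conjTranspose _ hX
    have hT : (expI Y s * X * expI Y (-s)).trace = 0 := by
      rw [Matrix.trace_mul_comm, ← mul_assoc, hu, one_mul, htrX]
    exact (hL _ hH hT).unique hH hT h1
  have h1 := (L.toContinuousLinearMap.hasFDerivAt (x := expI Y 0 * X * expI Y (-0))).comp_hasDerivAt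
    (0 : ℝ) (hasDerivAt_expI_conj X Y)
  have h2 := hasDerivAt_expI_conj (L X) (L Y)
  refine h1.unique (h2.congr_of_eventuallyEq (Eventually.of_forall fun s => hconj s))

theorem exists_eq_expI_of_mem_unitary {U : Matrix ι ι ℂ} (hU : U ∈ unitary (Matrix ι ι ℂ)) :
    ∃ H : Matrix ι ι ℂ, H.IsHermitian ∧ U = expI H 1 := by
  have hfin : (spectrum ℂ U).Finite := Matrix.finite_spectrum U
  -- Finiteness of the spectrum makes `Complex.arg` admissible for the functional calculus despite
  -- its branch cut.
  have hcont : ∀ f : ℂ → ℂ, ContinuousOn f (spectrum ℂ U) := fun f => hfin.continuousOn f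
  have hn : IsStarNormal U := ⟨by
    rw [Commute, SemiconjBy, (Unitary.mem_iff.mp hU).1, (Unitary.mem_iff.mp hU).2]⟩
  have hsa : IsSelfAdjoint (cfc (fun z : ℂ => (z.arg : ℂ)) U) := by
    rw [IsSelfAdjoint, ← cfc_star]
    refine cfc_congr fun z _ => ?_
    simp
  refine ⟨cfc (fun z : ℂ => (z.arg : ℂ)) U, hsa, ?_⟩
  have hcn := hsa.isStarNormal
  rw [expI, Complex.ofReal_one, mul_one, ← CFC.exp_eq_normedSpace_exp (𝕜 := ℂ),
    ← cfc_smul (hf := hcont _), ← cfc_comp' (hg := ((hfin.image _).continuousOn _))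
      (hf := hcont _)]
  conv_lhs => rw [← cfc_id' ℂ U]
  refine cfc_congr fun y hy ↦ ?_
  have hy₁ : ‖y‖ = 1 := spectrum.norm_eq_one_of_unitary hU hy
  have hy0 : y ≠ 0 := by rintro rfl; simp at hy₁
  have : Complex.I * y.arg = Complex.log y :=
    Complex.ext (by simp [Complex.log_re, hy₁]) (by simp [Complex.log_im])
  simp [← Complex.exp_eq_exp_ℂ, this, Complex.exp_log hy0]

/-- A Hermitian logarithm `H` of `U` need not be traceless, but `exp (i tr H) = det U = 1`. The
scalar part `s` of `H` is therefore exchanged for `s - D`, where `D` is diagonal with single entry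
`tr H`: it is traceless and `exp (i D) = 1`. This shows that the traceless exponentials generate the
whole group. -/
theorem exists_eq_expI_mul_expI [Nonempty ι] (U : Matrix.specialUnitaryGroup ι ℂ) :
    ∃ X Y : Matrix ι ι ℂ, (X.IsHermitian ∧ X.trace = 0) ∧ (Y.IsHermitian ∧ Y.trace = 0) ∧
      U.1 = expI X 1 * expI Y 1 := by
  obtain ⟨H, hH, hUH⟩ := exists_eq_expI_of_mem_unitary U.2.1
  obtain ⟨i₀⟩ := ‹Nonempty ι›
  set N : ℝ := (Fintype.card ι : ℝ) with hN
  have hN0 : N ≠ 0 := by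
    have : 0 < Fintype.card ι := Fintype.card_pos_iff.mpr ⟨i₀⟩
    positivity
  set τ : ℝ := H.trace.re / N with hτ
  have htrH : H.trace = ((N * τ : ℝ) : ℂ) := by
    have : star H.trace = H.trace := by rw [← Matrix.trace_conjTranspose, hH.eq]
    rw [hτ, mul_div_cancel₀ _ hN0]
    exact (Complex.conj_eq_iff_re.mp this).symm
  set s : Matrix ι ι ℂ := algebraMap ℂ (Matrix ι ι ℂ) τ with hs
  have hsH : s.IsHermitian := by
    rw [Matrix.IsHermitian, hs, Algebra.algebraMap_eq_smul_one, Matrix.conjTranspose_smul]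
    simp
  have htrs : s.trace = ((N * τ : ℝ) : ℂ) := by
    rw [hs, Algebra.algebraMap_eq_smul_one, Matrix.trace_smul, Matrix.trace_one, smul_eq_mul, hN]
    push_cast
    ring
  set D : Matrix ι ι ℂ := Matrix.diagonal (Pi.single i₀ ((N * τ : ℝ) : ℂ)) with hD
  have hDH : D.IsHermitian := by
    rw [Matrix.IsHermitian, hD, Matrix.diagonal_conjTranspose]
    congr 1
    rw [← Pi.single_star]
    congr 1
    exact Complex.conj_ofReal _
  have htrD : D.trace = ((N * τ : ℝ) : ℂ) := by
    rw [hD, Matrix.trace_diagonal, Finset.sum_pi_single']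
    simp
  have hXH : (H - s).IsHermitian := hH.sub hsH
  have hXtr : (H - s).trace = 0 := by rw [Matrix.trace_sub, htrH, htrs, sub_self]
  have hYH : (s - D).IsHermitian := hsH.sub hDH
  have hYtr : (s - D).trace = 0 := by rw [Matrix.trace_sub, htrs, htrD, sub_self]
  refine ⟨H - s, s - D, ⟨hXH, hXtr⟩, ⟨hYH, hYtr⟩, ?_⟩
  have hsplit : expI H 1 = expI (H - s) 1 * expI s 1 := by
    conv_lhs => rw [← sub_add_cancel H s]
    exact expI_mul_of_commute (Algebra.commutes' _ _ : s * _ = _).symm 1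
  have hscalar : expI s 1 = algebraMap ℂ (Matrix ι ι ℂ) (Complex.exp (Complex.I * τ)) := by
    rw [hs, expI_algebraMap, mul_one]
  have hdet : Complex.exp (Complex.I * ((N * τ : ℝ) : ℂ)) = 1 := by
    have h1 : (expI (H - s) 1).det = 1 :=
      (Matrix.mem_specialUnitaryGroup_iff.mp (exp_mem_specialUnitaryGroup hXH hXtr 1)).2
    have h2 := (Matrix.mem_specialUnitaryGroup_iff.mp U.2).2
    rw [hUH, hsplit, Matrix.det_mul, h1, one_mul, hscalar, Algebra.algebraMap_eq_smul_one,
      Matrix.det_smul, Matrix.det_one, mul_one, ← Complex.exp_nat_mul] at h2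
    rw [← h2, hN]
    congr 1
    push_cast
    ring
  have hDexp : expI (-D) 1 = 1 := by
    have hdiag : (Complex.I * ((1 : ℝ) : ℂ)) • (-D) = Matrix.diagonal fun i =>
        -(Complex.I * (Pi.single i₀ ((N * τ : ℝ) : ℂ) : ι → ℂ) i) := by
      ext i j
      rcases eq_or_ne i j with rfl | hij
      · simp [hD]
      · simp [hD, hij]
    rw [expI, hdiag, Matrix.exp_diagonal, ← Matrix.diagonal_one]
    congr 1
    funext i
    rw [Pi.coe_exp]
    by_cases hi : i = i₀
    · subst hi
      have : Complex.exp (-(Complex.I * ((N * τ : ℝ) : ℂ))) = 1 := by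
        rw [Complex.exp_neg, hdet, inv_one]
      rw [← Complex.exp_eq_exp_ℂ]
      simpa using this
    · simp [Pi.single_eq_of_ne hi]
  rw [hUH, hsplit]
  congr 1
  rw [sub_eq_add_neg, expI_mul_of_commute (Algebra.commutes' _ _ : s * _ = _) 1, hDexp, mul_one]

end LieAlgebra

/-! ### Algebra of tensor products of matrices. -/

section TensorPower

theorem matrixTensor_mul {k : ℕ} {ι : Type*} [Fintype ι] (A B : Fin k → Matrix ι ι ℂ) :
    matrixTensor A * matrixTensor B = matrixTensor fun j => A j * B j := by
  classical
  ext x y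
  simp only [Matrix.mul_apply, matrixTensor, Matrix.of_apply, ← Finset.prod_mul_distrib]
  rw [← Fintype.prod_sum fun j a => A j (x j) a * B j a (y j)]

theorem matrixTensor_one {k : ℕ} {ι : Type*} [DecidableEq ι] :
    matrixTensor (fun _ : Fin k => (1 : Matrix ι ι ℂ)) = 1 := by
  ext x y
  by_cases hxy : x = y
  · subst hxy
    simp [matrixTensor]
  · obtain ⟨j, hj⟩ := Function.ne_iff.mp hxy
    rw [Matrix.one_apply_ne hxy]
    exact Finset.prod_eq_zero (Finset.mem_univ j) (Matrix.one_apply_ne hj)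

theorem matrixTensor_smul {k : ℕ} {ι : Type*} (c : Fin k → ℂ) (A : Fin k → Matrix ι ι ℂ) :
    matrixTensor (fun j => c j • A j) = (∏ j, c j) • matrixTensor A := by
  ext x y
  simp [matrixTensor, Finset.prod_mul_distrib]

theorem trace_matrixTensor {k : ℕ} {ι : Type*} [Fintype ι] (A : Fin k → Matrix ι ι ℂ) :
    (matrixTensor A).trace = ∏ j, (A j).trace := by
  classical
  simp only [Matrix.trace, Matrix.diag_apply, matrixTensor, Matrix.of_apply]
  rw [← Fintype.prod_sum fun j a => A j a a]

theorem matrixTensor_conjTranspose {k : ℕ} {ι : Type*} (A : Fin k → Matrix ι ι ℂ) :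
    star (matrixTensor A) = matrixTensor fun j => star (A j) := by
  ext x y
  simp [matrixTensor]

theorem matrixTensor_update_apply {k : ℕ} {ι : Type*} [DecidableEq ι] (j : Fin k) (A : Matrix ι ι ℂ) (x y : Fin k → ι) :
    matrixTensor (Function.update 1 j A) x y =
      A (x j) (y j) * ∏ i ∈ Finset.univ.erase j, (1 : Matrix ι ι ℂ) (x i) (y i) := by
  simp only [matrixTensor, Matrix.of_apply]
  rw [← Finset.mul_prod_erase _ _ (Finset.mem_univ j), Function.update_self]
  congr 1
  exact Finset.prod_congr rfl fun i hi => by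
    rw [Function.update_of_ne (Finset.ne_of_mem_erase hi)]; rfl

end TensorPower

/-! ### Multiplication, counting and completeness of Pauli strings. -/

section PauliStrings

/-- The product of two one-qubit Pauli labels, up to phase. -/
def labelMul : Fin 4 → Fin 4 → Fin 4 :=
  ![![0, 1, 2, 3], ![1, 0, 3, 2], ![2, 3, 0, 1], ![3, 2, 1, 0]]

/-- The phase in the product of two one-qubit Pauli matrices. -/
def labelPhase : Fin 4 → Fin 4 → ℂ :=
  ![![1, 1, 1, 1], ![1, 1, Complex.I, -Complex.I], ![1, -Complex.I, 1, Complex.I],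
    ![1, Complex.I, -Complex.I, 1]]

theorem sigma_mul_sigma (a b : Fin 4) :
    sigma a * sigma b = labelPhase a b • sigma (labelMul a b) := by
  fin_cases a <;> fin_cases b <;> ext i j <;> fin_cases i <;> fin_cases j <;>
    simp [sigma, labelPhase, labelMul, Matrix.mul_apply, Fin.sum_univ_two]

theorem labelMul_labelMul (a b : Fin 4) : labelMul a (labelMul a b) = b := by
  revert a b; decide

theorem labelMul_comm (a b : Fin 4) : labelMul a b = labelMul b a := by
  revert a b; decide

theorem labelMul_eq_zero {a b : Fin 4} : labelMul a b = 0 → a = b := by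
  revert a b; decide

theorem labelPhase_swap (a b : Fin 4) : labelPhase b a = star (labelPhase a b) := by
  fin_cases a <;> fin_cases b <;> simp [labelPhase]

theorem labelPhase_labelMul (a b : Fin 4) :
    labelPhase a (labelMul a b) = star (labelPhase a b) := by
  fin_cases a <;> fin_cases b <;> simp [labelPhase, labelMul]

theorem labelPhase_labelMul_right (a b : Fin 4) :
    labelPhase b (labelMul a b) = labelPhase a b := by
  fin_cases a <;> fin_cases b <;> simp [labelPhase, labelMul]

theorem labelPhase_pow_four (a b : Fin 4) : labelPhase a b ^ 4 = 1 := by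
  fin_cases a <;> fin_cases b <;> simp [labelPhase, Even.neg_pow (show Even 4 by decide)]

theorem sum_labelPhase_sq {a : Fin 4} (ha : a ≠ 0) : ∑ b, labelPhase a b ^ 2 = 0 := by
  fin_cases a <;> simp_all [labelPhase, Fin.sum_univ_four]

/-- Completeness of the Pauli basis: the sum of `σ ⊗ σ` is twice the swap. -/
theorem sum_sigma_mul_sigma (i j k l : Fin 2) :
    ∑ a, sigma a i j * sigma a k l = if i = l ∧ j = k then 2 else 0 := by
  have h0 : sigma 0 = 1 := rfl
  have h1 : sigma 1 = !![0, 1; 1, 0] := rfl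
  have h2 : sigma 2 = !![0, -Complex.I; Complex.I, 0] := rfl
  have h3 : sigma 3 = !![1, 0; 0, -1] := rfl
  rw [Fin.sum_univ_four, h0, h1, h2, h3]
  fin_cases i <;> fin_cases j <;> fin_cases k <;> fin_cases l <;> norm_num

variable {n : ℕ}

/-- The Pauli string with labels `s`. -/
def pauliString (s : Fin n → Fin 4) : Matrix (Qubits n) (Qubits n) ℂ :=
  matrixTensor fun j => sigma (s j)

/-- The product of the labels of two Pauli strings. -/
def stringMul (s t : Fin n → Fin 4) : Fin n → Fin 4 := fun j => labelMul (s j) (t j)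

/-- The phase in the product of two Pauli strings. -/
def stringPhase (s t : Fin n → Fin 4) : ℂ := ∏ j, labelPhase (s j) (t j)

theorem pauliString_mul (s t : Fin n → Fin 4) :
    pauliString s * pauliString t = stringPhase s t • pauliString (stringMul s t) := by
  rw [pauliString, pauliString, matrixTensor_mul]
  simp_rw [sigma_mul_sigma]
  rw [matrixTensor_smul]
  rfl

theorem pauliString_zero : pauliString (0 : Fin n → Fin 4) = 1 := by
  rw [← matrixTensor_one]
  rfl

theorem pauliString_isHermitian (s : Fin n → Fin 4) : (pauliString s).IsHermitian := by
  have hσ : ∀ k a b, star (sigma k a b) = sigma k b a := by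
    intro k a b
    fin_cases k <;> fin_cases a <;> fin_cases b <;> simp [sigma]
  ext x y
  simp only [pauliString, matrixTensor, Matrix.conjTranspose_apply, Matrix.of_apply, star_prod, hσ]

theorem pauliString_trace {s : Fin n → Fin 4} (hs : s ≠ 0) : (pauliString s).trace = 0 := by
  obtain ⟨j, hj⟩ := Function.ne_iff.mp hs
  have h0 : ∀ k : Fin 4, k ≠ 0 → (sigma k).trace = 0 := by
    intro k hk
    fin_cases k <;> simp_all [sigma, Matrix.trace]
  rw [pauliString, trace_matrixTensor]
  exact Finset.prod_eq_zero (Finset.mem_univ j) (h0 _ hj)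

theorem pauliString_ne_one {s : Fin n → Fin 4} (hs : s ≠ 0) : pauliString s ≠ 1 := by
  intro h
  have := pauliString_trace hs
  rw [h, Matrix.trace_one] at this
  simp at this

theorem stringMul_stringMul (s t : Fin n → Fin 4) : stringMul s (stringMul s t) = t :=
  funext fun _ => labelMul_labelMul _ _

theorem stringMul_comm (s t : Fin n → Fin 4) : stringMul s t = stringMul t s :=
  funext fun _ => labelMul_comm _ _

theorem stringMul_eq_zero {s t : Fin n → Fin 4} (h : stringMul s t = 0) : s = t :=
  funext fun j => labelMul_eq_zero (congrFun h j)

theorem stringPhase_swap (s t : Fin n → Fin 4) : stringPhase t s = star (stringPhase s t) := by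
  rw [stringPhase, stringPhase, star_prod]
  exact Finset.prod_congr rfl fun j _ => labelPhase_swap _ _

theorem stringPhase_stringMul (s t : Fin n → Fin 4) :
    stringPhase s (stringMul s t) = star (stringPhase s t) := by
  simp [stringPhase, stringMul, labelPhase_labelMul]

theorem stringPhase_stringMul_right (s t : Fin n → Fin 4) :
    stringPhase t (stringMul s t) = stringPhase s t := by
  simp [stringPhase, stringMul, labelPhase_labelMul_right]

theorem stringPhase_pow_four (s t : Fin n → Fin 4) : stringPhase s t ^ 4 = 1 := by
  simp [stringPhase, ← Finset.prod_pow, labelPhase_pow_four]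

theorem stringPhase_self (s : Fin n → Fin 4) : stringPhase s s = 1 := by
  refine Finset.prod_eq_one fun j _ => ?_
  generalize s j = a
  fin_cases a <;> simp [labelPhase]

theorem stringPhase_zero_left (t : Fin n → Fin 4) : stringPhase 0 t = 1 := by
  refine Finset.prod_eq_one fun j _ => ?_
  generalize t j = a
  fin_cases a <;> simp [labelPhase]

/-- The phase is a fourth root of unity. The first form makes anticommuting strings countable
through a sum of squared phases, which factorizes over the qubits. -/
theorem stringPhase_im_sq {s t : Fin n → Fin 4} :
    (stringPhase s t).im ^ 2 = (1 - (stringPhase s t ^ 2).re) / 2 ∧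
      ((stringPhase s t).im = 0 ∨ (stringPhase s t).im ^ 2 = 1) := by
  have h4 := stringPhase_pow_four s t
  have h2 : (stringPhase s t ^ 2 - 1) * (stringPhase s t ^ 2 + 1) = 0 := by
    linear_combination h4
  rcases mul_eq_zero.mp h2 with h | h
  · rcases sq_eq_sq_iff_eq_or_eq_neg.mp ((sub_eq_zero.mp h).trans (one_pow 2).symm) with h | h <;> simp [h]
  · have h1 : (stringPhase s t - Complex.I) * (stringPhase s t + Complex.I) = 0 := by
      linear_combination h - Complex.I_sq
    rcases mul_eq_zero.mp h1 with h | h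
    · simp [sub_eq_zero.mp h]
    · simp [eq_neg_of_add_eq_zero_left h]

/-- Half of all strings anticommute with a nonidentity one: the sum of squared phases has a
vanishing factor at any qubit where `s` is nontrivial. -/
theorem sum_stringPhase_im_sq {s : Fin n → Fin 4} (hs : s ≠ 0) :
    ∑ t, (stringPhase s t).im ^ 2 = (4 : ℝ) ^ n / 2 := by
  obtain ⟨j, hj⟩ := Function.ne_iff.mp hs
  have h0 : ∑ t, stringPhase s t ^ 2 = 0 := by
    simp only [stringPhase, ← Finset.prod_pow]
    rw [← Fintype.prod_sum fun j a => labelPhase (s j) a ^ 2]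
    exact Finset.prod_eq_zero (Finset.mem_univ j) (sum_labelPhase_sq hj)
  simp_rw [stringPhase_im_sq.1]
  rw [← Finset.sum_div, Finset.sum_sub_distrib, ← Complex.re_sum, h0]
  simp

theorem pauliString_injective : Function.Injective (pauliString (n := n)) := by
  intro s t hst
  by_contra hne
  have h0 : stringMul s t ≠ 0 := fun h => hne (stringMul_eq_zero h)
  have hself : stringMul t t = 0 := by
    refine funext fun j => ?_
    change labelMul (t j) (t j) = 0
    generalize t j = a
    revert a
    decide
  have h1 : pauliString s * pauliString t = 1 := by
    rw [hst, pauliString_mul, hself, stringPhase_self, one_smul, pauliString_zero]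
  have h2 := congrArg Matrix.trace h1
  rw [pauliString_mul, Matrix.trace_smul, pauliString_trace h0, Matrix.trace_one, smul_zero] at h2
  simp at h2
  exact pow_ne_zero n two_ne_zero h2.symm

theorem sum_pauliString_apply (i j k l : Qubits n) :
    ∑ t : Fin n → Fin 4, pauliString t i j * pauliString t k l =
      if i = l ∧ j = k then 2 ^ n else 0 := by
  simp only [pauliString, matrixTensor, Matrix.of_apply, ← Finset.prod_mul_distrib]
  rw [← Fintype.prod_sum fun q a => sigma a (i q) (j q) * sigma a (k q) (l q)]
  simp_rw [sum_sigma_mul_sigma]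
  split_ifs with h
  · obtain ⟨rfl, rfl⟩ := h
    simp
  · have : ∃ q, ¬ (i q = l q ∧ j q = k q) := by
      by_contra! hall
      exact h ⟨funext fun q => (hall q).1, funext fun q => (hall q).2⟩
    obtain ⟨q, hq⟩ := this
    exact Finset.prod_eq_zero (Finset.mem_univ q) (if_neg hq)

/-- Traceless Hermitian matrices are real combinations of nonidentity Pauli strings. -/
theorem exists_eq_sum_pauliString {X : Matrix (Qubits n) (Qubits n) ℂ} (hX : X.IsHermitian)
    (htr : X.trace = 0) :
    ∃ c : (Fin n → Fin 4) → ℝ, X = ∑ t ∈ Finset.univ.erase 0, c t • pauliString t := by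
  have h1 : ∀ t, star (pauliString t * X).trace = (pauliString t * X).trace := by
    intro t
    rw [← Matrix.trace_conjTranspose, Matrix.conjTranspose_mul, hX.eq,
      (pauliString_isHermitian t).eq, Matrix.trace_mul_comm]
  have hreal : ∀ t, (((pauliString t * X).trace.re : ℝ) : ℂ) = (pauliString t * X).trace :=
    fun t => Complex.conj_eq_iff_re.mp (h1 t)
  refine ⟨fun t => (2 ^ n : ℝ)⁻¹ * (pauliString t * X).trace.re, ?_⟩
  have h2 : X = ∑ t, ((2 ^ n : ℝ)⁻¹ * (pauliString t * X).trace.re) • pauliString t := by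
    ext i j
    rw [Matrix.sum_apply]
    simp only [Matrix.smul_apply, Complex.real_smul]
    push_cast
    simp_rw [hreal, Matrix.trace, Matrix.diag_apply, Matrix.mul_apply, mul_assoc, Finset.sum_mul,
      ← Finset.mul_sum]
    have h3 : ∑ t : Fin n → Fin 4, ∑ k, ∑ l, pauliString t k l * X l k * pauliString t i j =
        2 ^ n * X i j := by
      rw [Finset.sum_comm]
      simp_rw [Finset.sum_comm (s := (Finset.univ : Finset (Fin n → Fin 4)))]
      have h4 : ∀ k l, ∑ t : Fin n → Fin 4, pauliString t k l * X l k * pauliString t i j =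
          if k = j ∧ l = i then 2 ^ n * X l k else 0 := by
        intro k l
        rw [← ite_zero_mul, ← sum_pauliString_apply, Finset.sum_mul]
        exact Finset.sum_congr rfl fun t _ => by ring
      simp_rw [h4, ite_and]
      simp
    rw [h3, inv_mul_cancel_left₀ (pow_ne_zero _ two_ne_zero)]
  conv_lhs => rw [h2]
  rw [← Finset.add_sum_erase _ _ (Finset.mem_univ 0), pauliString_zero, one_mul, htr]
  simp

theorem pauliSet_eq_image :
    pauliSet n = (Finset.univ.erase 0).image (pauliString (n := n)) := by
  classical
  rw [pauliSet]
  ext P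
  simp only [Finset.mem_erase, Finset.mem_image, Finset.mem_univ, true_and, and_true]
  constructor
  · rintro ⟨hP, s, rfl⟩
    exact ⟨s, fun h => hP (by subst h; exact pauliString_zero), rfl⟩
  · rintro ⟨s, hs, rfl⟩
    exact ⟨pauliString_ne_one hs, s, rfl⟩

theorem pauliMean_eq_sum {E : Type*} [AddCommGroup E] [Module ℝ E]
    (f : Matrix (Qubits n) (Qubits n) ℂ → E) :
    pauliMean n (fun P => f P.1) =
      ((4 : ℝ) ^ n - 1)⁻¹ • ∑ t ∈ Finset.univ.erase 0, f (pauliString t) := by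
  classical
  have hcard : ((pauliSet n).card : ℝ) = (4 : ℝ) ^ n - 1 := by
    rw [pauliSet_eq_image, Finset.card_image_of_injective _ pauliString_injective,
      Finset.card_erase_of_mem (Finset.mem_univ _), Nat.cast_sub (Finset.card_pos.mpr ⟨0, Finset.mem_univ _⟩)]
    simp
  rw [pauliMean, hcard, Finset.sum_coe_sort (pauliSet n) f, pauliSet_eq_image,
    Finset.sum_image pauliString_injective.injOn]

end PauliStrings

/-! ### Averages of unitaries as orthogonal projections. -/

section Averages

open Filter Topology

variable {A : Type*} [CStarAlgebra A]

theorem expI_of_sq_eq_one {a : A} (ha : a * a = 1) (θ : ℝ) :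
    expI a θ = Real.cos θ • (1 : A) + Real.sin θ • (Complex.I • a) := by
  have hIa : (Complex.I • a) * (Complex.I • a) = -(1 : A) := by
    rw [smul_mul_smul_comm, ha, Complex.I_mul_I, neg_smul, one_smul]
  have hd : ∀ θ : ℝ, HasDerivAt (fun θ : ℝ =>
      (Real.cos θ • (1 : A) + Real.sin θ • (Complex.I • a)) * expI a (-θ)) 0 θ := by
    intro θ
    have h1 : HasDerivAt (fun s => expI a (-s)) (-((Complex.I • a) * expI a (-θ))) θ :=
      ((hasDerivAt_expI' a (-θ)).scomp θ (hasDerivAt_neg θ)).congr_deriv (by simp)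
    have h2 := (((Real.hasDerivAt_cos θ).smul_const (1 : A)).add
      ((Real.hasDerivAt_sin θ).smul_const (Complex.I • a))).mul h1
    refine h2.congr_deriv ?_
    have h3 : (Real.cos θ • (1 : A) + Real.sin θ • (Complex.I • a)) * (Complex.I • a) =
        -Real.sin θ • (1 : A) + Real.cos θ • (Complex.I • a) := by
      rw [add_mul, smul_mul_assoc, smul_mul_assoc, hIa, one_mul, smul_neg, neg_smul, add_comm]
    change _ + (Real.cos θ • (1 : A) + Real.sin θ • (Complex.I • a)) * _ = _
    rw [mul_neg, ← mul_assoc, h3, add_neg_cancel]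
  have hc := is_const_of_deriv_eq_zero (fun t => (hd t).differentiableAt) (fun t => (hd t).deriv) θ 0
  simp only [Real.cos_zero, Real.sin_zero, one_smul, zero_smul, add_zero, neg_zero, expI_zero,
    one_mul] at hc
  have hinv : expI a (-θ) * expI a θ = 1 := by rw [← expI_add, neg_add_cancel, expI_zero]
  calc expI a θ = (Real.cos θ • (1 : A) + Real.sin θ • (Complex.I • a)) * expI a (-θ) *
        expI a θ := by rw [hc, one_mul]
    _ = _ := by rw [mul_assoc, hinv, mul_one]

theorem norm_expI_sub_one_le {a : A} (ha : IsSelfAdjoint a) (θ : ℝ) :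
    ‖expI a θ - 1‖ ≤ ‖a‖ * |θ| := by
  have h := Convex.norm_image_sub_le_of_norm_hasDerivWithin_le (f := expI a)
    (f' := fun θ => (Complex.I • a) * expI a θ) (C := ‖a‖) (s := Set.univ) (x := 0) (y := θ)
    (fun x _ => (hasDerivAt_expI' a x).hasDerivWithinAt) (fun x _ => ?_) convex_univ
    (Set.mem_univ _) (Set.mem_univ _)
  · simpa [expI_zero] using h
  · have h1 := norm_le_one_of_mem_unitary (expI_mem_unitary ha x)
    calc ‖(Complex.I • a) * expI a x‖ ≤ ‖Complex.I • a‖ * ‖expI a x‖ := norm_mul_le _ _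
      _ ≤ ‖a‖ * 1 := by rw [norm_smul, Complex.norm_I, one_mul]; gcongr
      _ = ‖a‖ := mul_one _

/-- The generator is `-i` times the derivative at `0`. This bounds its norm without computing it. -/
theorem norm_le_of_norm_expI_sub_one_le {a : A} {C : ℝ} (hC : 0 ≤ C)
    (h : ∀ θ, ‖expI a θ - 1‖ ≤ C * |θ|) : ‖a‖ ≤ C := by
  have h1 := (hasDerivAt_expI_zero a).le_of_lip' hC (Eventually.of_forall fun θ => by
    simpa [expI_zero] using h θ)
  simpa [norm_smul] using h1

variable {V : Type*} [NormedAddCommGroup V] [InnerProductSpace ℂ V] [CompleteSpace V]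

theorem hasDerivAt_expI_apply (a : V →L[ℂ] V) (y : V) (θ : ℝ) :
    HasDerivAt (fun θ => expI a θ y) (expI a θ ((Complex.I • a) y)) θ :=
  (((ContinuousLinearMap.apply ℂ V y).restrictScalars ℝ).hasFDerivAt
    (x := expI a θ)).comp_hasDerivAt θ (hasDerivAt_expI a θ)

theorem expI_apply_eq_self_iff (a : V →L[ℂ] V) (y : V) : (∀ θ, expI a θ y = y) ↔ a y = 0 := by
  constructor
  · intro h
    have h1 := hasDerivAt_expI_apply a y 0
    rw [funext h, expI_zero] at h1
    have h2 : Complex.I • a y = 0 := h1.unique (hasDerivAt_const 0 y)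
    exact (smul_eq_zero.mp h2).resolve_left Complex.I_ne_zero
  · intro h θ
    have hd : ∀ θ, HasDerivAt (fun θ => expI a θ y) 0 θ := fun θ => by
      have := hasDerivAt_expI_apply a y θ
      rwa [smul_apply, h, smul_zero, map_zero] at this
    have := is_const_of_deriv_eq_zero (fun t => (hd t).differentiableAt) (fun t => (hd t).deriv) θ 0
    simpa [expI_zero] using this

/-- An average of unitaries fixing `K` pointwise and with image in `K` is the orthogonal projection
onto `K`. -/
theorem integral_unitary_eq_starProjection {Ω : Type*} [MeasurableSpace Ω] {μ : Measure Ω}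
    [IsProbabilityMeasure μ] {f : Ω → V →L[ℂ] V} (hf : Integrable f μ)
    (hun : ∀ ω, f ω ∈ unitary (V →L[ℂ] V)) {K : Submodule ℂ V} [K.HasOrthogonalProjection]
    (hfix : ∀ ω, ∀ y ∈ K, f ω y = y) (hmem : ∀ x, (∫ ω, f ω ∂μ) x ∈ K) :
    ∫ ω, f ω ∂μ = K.starProjection := by
  ext x
  symm
  refine Submodule.eq_starProjection_of_mem_of_inner_eq_zero (hmem x) fun w hw => ?_
  have hstar : ∀ ω, star (f ω) w = w := by
    intro ω
    have h1 := congrArg (fun a : V →L[ℂ] V => a w) (Unitary.mem_iff.mp (hun ω)).1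
    change star (f ω) (f ω w) = w at h1
    rwa [hfix ω w hw] at h1
  have h2 : inner ℂ w ((∫ ω, f ω ∂μ) x) = inner ℂ w x := by
    have h3 := ((innerSL ℂ w).comp (ContinuousLinearMap.apply ℂ V x)).integral_comp_comm hf
    change ∫ ω, inner ℂ w (f ω x) ∂μ = inner ℂ w ((∫ ω, f ω ∂μ) x) at h3
    rw [← h3]
    have h4 : ∀ ω, inner ℂ w (f ω x) = inner ℂ w x := fun ω => by
      rw [← ContinuousLinearMap.adjoint_inner_left, ← ContinuousLinearMap.star_eq_adjoint, hstar]
    simp [h4]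
  rw [inner_eq_zero_symm, inner_sub_right, h2, sub_self]

/-- The interval is one full period of `θ ↦ expI a (θ / 2)`, so the derivative integrates to zero
and `a` annihilates the average. -/
theorem average_expI_eq_starProjection [FiniteDimensional ℂ V] {a : V →L[ℂ] V}
    (ha : IsSelfAdjoint a) (hper : expI a (2 * Real.pi) = 1) :
    ⨍ θ in Set.Ioo (-(2 * Real.pi)) (2 * Real.pi), expI a (θ / 2) = a.ker.starProjection := by
  have hpi := Real.pi_pos
  have hcont : Continuous fun θ : ℝ => expI a (θ / 2) :=
    (continuous_expI a).comp (continuous_id.div_const 2)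
  set μ : Measure ℝ := volume.restrict (Set.Ioo (-(2 * Real.pi)) (2 * Real.pi)) with hμ
  have hμ0 : μ Set.univ = ENNReal.ofReal (4 * Real.pi) := by
    rw [hμ, Measure.restrict_apply_univ, Real.volume_Ioo]
    congr 1
    ring
  have : IsFiniteMeasure μ := ⟨by rw [hμ0]; exact ENNReal.ofReal_lt_top⟩
  have : NeZero μ := ⟨fun h => by
    rw [h] at hμ0
    have : (0 : ENNReal) < ENNReal.ofReal (4 * Real.pi) := ENNReal.ofReal_pos.mpr (by positivity)
    rw [← hμ0] at this
    simp at this⟩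
  have hint : Integrable (fun θ : ℝ => expI a (θ / 2)) μ :=
    (hcont.integrableOn_Icc (a := -(2 * Real.pi)) (b := 2 * Real.pi)).mono_set Set.Ioo_subset_Icc_self
  refine integral_unitary_eq_starProjection (μ := (μ Set.univ)⁻¹ • μ)
    (hint.smul_measure (by simp [hμ0, hpi])) (fun θ => expI_mem_unitary ha _)
    (fun θ y hy => (expI_apply_eq_self_iff a y).mpr hy _) fun x => ?_
  change a ((⨍ θ, expI a (θ / 2) ∂μ) x) = 0
  have hzero : (Complex.I • a) * ∫ θ, expI a (θ / 2) ∂μ = 0 := by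
    have h1 : ∀ θ : ℝ, HasDerivAt (fun θ => expI a (θ / 2))
        ((2 : ℝ)⁻¹ • ((Complex.I • a) * expI a (θ / 2))) θ := fun θ => by
      have := (hasDerivAt_expI' a (θ / 2)).scomp θ ((hasDerivAt_id θ).div_const 2)
      exact this.congr_deriv (by simp)
    have hcont' : Continuous fun θ : ℝ => (2 : ℝ)⁻¹ • ((Complex.I • a) * expI a (θ / 2)) :=
      by fun_prop
    have h2 := intervalIntegral.integral_eq_sub_of_hasDerivAt
      (a := -(2 * Real.pi)) (b := 2 * Real.pi) (fun θ _ => h1 θ)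
      (hcont'.intervalIntegrable _ _)
    have h3 : expI a (2 * Real.pi / 2) = expI a (-(2 * Real.pi) / 2) := by
      rw [show 2 * Real.pi / 2 = -(2 * Real.pi) / 2 + 2 * Real.pi by ring, expI_add, hper, mul_one]
    rw [h3, sub_self, intervalIntegral.integral_smul] at h2
    have h4 := (smul_eq_zero.mp h2).resolve_left (by norm_num)
    rw [intervalIntegral.integral_of_le (by linarith), integral_Ioc_eq_integral_Ioo] at h4
    have h5 := ((ContinuousLinearMap.mul ℝ (V →L[ℂ] V)) (Complex.I • a)).integral_comp_comm hint
    simp only [ContinuousLinearMap.mul_apply'] at h5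
    rw [← h5, ← h4]
  have h6 : a * ∫ θ, expI a (θ / 2) ∂μ = 0 := by
    rw [smul_mul_assoc] at hzero
    exact (smul_eq_zero.mp hzero).resolve_left Complex.I_ne_zero
  have h7 : a * (⨍ θ, expI a (θ / 2) ∂μ) = 0 := by
    rw [average_eq, mul_smul_comm, h6, smul_zero]
  exact congrArg (fun f : V →L[ℂ] V => f x) h7

end Averages

/-! ### The gap bound for an arbitrary representation of `SU (2 ^ n)`. -/

section PauliRotations

variable {n : ℕ}

instance : IsProbabilityMeasure (haarSU n) :=
  ⟨by simpa [haarSU] using Measure.haarMeasure_self (K₀ := (⊤ : TopologicalSpace.PositiveCompacts (SU n)))⟩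

instance : Measure.IsHaarMeasure (haarSU n) := Measure.isHaarMeasure_haarMeasure _

theorem pauliString_mul_self (t : Fin n → Fin 4) : pauliString t * pauliString t = 1 := by
  have hself : stringMul t t = 0 := by
    refine funext fun j => ?_
    change labelMul (t j) (t j) = 0
    generalize t j = a
    revert a
    decide
  rw [pauliString_mul, hself, stringPhase_self, one_smul, pauliString_zero]

variable {V : Type*} [NormedAddCommGroup V] [InnerProductSpace ℂ V] [CompleteSpace V]
  {ρ : SU n →* unitary (V →L[ℂ] V)}

theorem isPauliFamily_of_isGenerator
    {L : Matrix (Qubits n) (Qubits n) ℂ →ₗ[ℝ] V →L[ℂ] V}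
    (hL : ∀ X : Matrix (Qubits n) (Qubits n) ℂ, X.IsHermitian → X.trace = 0 →
      IsGenerator ρ X (L X)) {h : (Fin n → Fin 4) → V →L[ℂ] V} (h0 : h 0 = 0)
    (h1 : ∀ t, t ≠ 0 → h t = L (pauliString t)) :
    IsPauliFamily h stringMul (fun s t => (stringPhase s t).im) where
  selfAdjoint t := by
    by_cases ht : t = 0
    · rw [ht, h0]; exact IsSelfAdjoint.zero _
    · rw [h1 t ht]
      exact (hL _ (pauliString_isHermitian t) (pauliString_trace ht)).selfAdjoint
  commutator r t := by
    by_cases hr : r = 0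
    · simp [hr, h0, stringPhase_zero_left]
    by_cases ht : t = 0
    · rw [ht, h0, stringPhase_swap 0 r, stringPhase_zero_left]
      simp
    by_cases hrt : stringMul r t = 0
    · rw [stringMul_eq_zero hrt, stringPhase_self]
      simp
    have hbr := map_commutator hL (pauliString_isHermitian t) (pauliString_trace ht)
      (pauliString_isHermitian r) (pauliString_trace hr)
    -- Swapping two strings conjugates the phase, so the commutator retains only `2 i` times its
    -- imaginary part.
    have hcomm : Complex.I • (pauliString r * pauliString t - pauliString t * pauliString r) =
        (-2 * (stringPhase r t).im : ℝ) • pauliString (stringMul r t) := by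
      rw [pauliString_mul, pauliString_mul, stringMul_comm t r, stringPhase_swap r t, ← sub_smul,
        smul_smul, ← Complex.coe_smul]
      congr 1
      apply Complex.ext <;> simp
      ring
    rw [hcomm, map_smul] at hbr
    rw [h1 r hr, h1 t ht, h1 _ hrt]
    have h2 := congrArg (fun f : V →L[ℂ] V => (-Complex.I) • f) hbr
    simp only [smul_smul, neg_mul, Complex.I_mul_I, neg_neg, one_smul] at h2
    rw [← h2, ← Complex.coe_smul, smul_smul]
    congr 1
    push_cast
    ring
  op_op := stringMul_stringMul
  coeff_op r t := by rw [stringPhase_stringMul]; simp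
  coeff_sq r t hb := stringPhase_im_sq.2.resolve_left hb
  op_right r t _ := by rw [stringMul_comm r t, stringMul_stringMul]
  coeff_right r t _ := by rw [stringPhase_stringMul_right]

variable [FiniteDimensional ℂ V]

/-- The joint kernel consists of the vectors fixed by `ρ`, because every group element is a product
of two exponentials of real combinations of strings. Left invariance of Haar measure places the
average there. -/
theorem integral_haarSU_eq_starProjection (hρ : Continuous ρ)
    {L : Matrix (Qubits n) (Qubits n) ℂ →ₗ[ℝ] V →L[ℂ] V}
    (hL : ∀ X : Matrix (Qubits n) (Qubits n) ℂ, X.IsHermitian → X.trace = 0 →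
      IsGenerator ρ X (L X)) {h : (Fin n → Fin 4) → V →L[ℂ] V} (h0 : h 0 = 0)
    (h1 : ∀ t, t ≠ 0 → h t = L (pauliString t)) :
    ∫ U : SU n, (ρ U : V →L[ℂ] V) ∂haarSU n = (⨅ t, (h t).ker).starProjection := by
  have hc : Continuous fun U : SU n => (ρ U : V →L[ℂ] V) := continuous_subtype_val.comp hρ
  refine integral_unitary_eq_starProjection
    (hc.integrable_of_hasCompactSupport (HasCompactSupport.of_compactSpace _)) (fun U => (ρ U).2)
    (fun U y hy => ?_) fun x => ?_
  · rw [Submodule.mem_iInf] at hy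
    have hfix : ∀ X : Matrix (Qubits n) (Qubits n) ℂ, X.IsHermitian → X.trace = 0 →
        L X y = 0 := by
      intro X hX htr
      obtain ⟨c, rfl⟩ := exists_eq_sum_pauliString hX htr
      rw [map_sum, sum_apply]
      refine Finset.sum_eq_zero fun t ht => ?_
      have : h t y = 0 := hy t
      rw [h1 t (Finset.ne_of_mem_erase ht)] at this
      rw [map_smul, smul_apply, this, smul_zero]
    obtain ⟨X, Y, ⟨hX, htX⟩, ⟨hY, htY⟩, hU⟩ := exists_eq_expI_mul_expI U
    have : U = suExp hX htX 1 * suExp hY htY 1 := Subtype.ext hU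
    rw [this, map_mul]
    change (ρ (suExp hX htX 1) : V →L[ℂ] V) ((ρ (suExp hY htY 1) : V →L[ℂ] V) y) = y
    rw [(hL X hX htX).map_eq 1 _ rfl, (hL Y hY htY).map_eq 1 _ rfl,
      (expI_apply_eq_self_iff _ y).mpr (hfix Y hY htY),
      (expI_apply_eq_self_iff _ y).mpr (hfix X hX htX)]
  · have hinv : ∀ U : SU n, (ρ U : V →L[ℂ] V) * ∫ U : SU n, (ρ U : V →L[ℂ] V) ∂haarSU n =
        ∫ U : SU n, (ρ U : V →L[ℂ] V) ∂haarSU n := by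
      intro U
      have h5 := ((ContinuousLinearMap.mul ℝ (V →L[ℂ] V)) (ρ U : V →L[ℂ] V)).integral_comp_comm
        (hc.integrable_of_hasCompactSupport (HasCompactSupport.of_compactSpace _) (μ := haarSU n))
      simp only [ContinuousLinearMap.mul_apply'] at h5
      rw [← h5]
      simp_rw [← Submonoid.coe_mul, ← map_mul]
      exact integral_mul_left_eq_self (fun W : SU n => (ρ W : V →L[ℂ] V)) U
    rw [Submodule.mem_iInf]
    intro t
    change h t _ = 0
    by_cases ht : t = 0
    · rw [ht, h0]; rfl
    · rw [h1 t ht, ← expI_apply_eq_self_iff]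
      intro θ
      have hgen := hL _ (pauliString_isHermitian t) (pauliString_trace ht)
      rw [← hgen.map_eq θ (suExp (pauliString_isHermitian t) (pauliString_trace ht) θ) rfl]
      exact congrArg (fun f : V →L[ℂ] V => f x) (hinv _)

theorem norm_pauliMean_sub_haar_le (hn : 1 ≤ n) (hρ : Continuous ρ) {K g : ℝ} (hK0 : 0 ≤ K)
    (hK : ∀ t, t ≠ 0 → ∀ a, IsGenerator ρ (pauliString t) a → ‖a‖ ≤ K) (hg1 : g ≤ 1)
    (hg : g * ((4 : ℝ) ^ n - 1) * K ≤ K + (4 : ℝ) ^ n / 2) :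
    ‖(⨍ θ in Set.Ioo (-(2 * Real.pi)) (2 * Real.pi), pauliMean n fun P =>
          (ρ (pauliRotation P θ) : V →L[ℂ] V))
        - ∫ U : SU n, (ρ U : V →L[ℂ] V) ∂haarSU n‖ ≤ 1 - g := by
  obtain ⟨L, hL⟩ := exists_linear_generator hρ
  -- `L` is meaningless on the identity string, so its generator is set to zero by hand.
  set h : (Fin n → Fin 4) → V →L[ℂ] V := fun t => if t = 0 then 0 else L (pauliString t) with hdef
  have h0 : h 0 = 0 := if_pos rfl
  have h1 : ∀ t, t ≠ 0 → h t = L (pauliString t) := fun t ht => if_neg ht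
  have hgen : ∀ t, t ≠ 0 → IsGenerator ρ (pauliString t) (h t) := fun t ht => by
    rw [h1 t ht]; exact hL _ (pauliString_isHermitian t) (pauliString_trace ht)
  have hm : (((Finset.univ.erase (0 : Fin n → Fin 4)).card : ℕ) : ℝ) = (4 : ℝ) ^ n - 1 := by
    rw [Finset.card_erase_of_mem (Finset.mem_univ _),
      Nat.cast_sub (Finset.card_pos.mpr ⟨0, Finset.mem_univ _⟩)]
    simp
  have hm0 : (0 : ℝ) < (4 : ℝ) ^ n - 1 := by
    have := one_lt_pow₀ (show (1 : ℝ) < 4 by norm_num) (by omega : n ≠ 0)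
    linarith
  have hmain := (isPauliFamily_of_isGenerator hL h0 h1).norm_mean_sub_le h0
    (A := (4 : ℝ) ^ n / 2) (by positivity) (fun r hr => sum_stringPhase_im_sq hr) hm hm0
    (K := K) (g := g) (fun t => ?_) hg1 hg
  · rw [integral_haarSU_eq_starProjection hρ hL h0 h1]
    convert hmain using 3
    have hmean : ∀ θ : ℝ, (pauliMean n fun P => (ρ (pauliRotation P θ) : V →L[ℂ] V)) =
        ((4 : ℝ) ^ n - 1)⁻¹ • ∑ t ∈ Finset.univ.erase 0, expI (h t) (θ / 2) := by
      intro θ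
      have h2 : (fun P : pauliSet n => (ρ (pauliRotation P θ) : V →L[ℂ] V)) =
          fun P => expI (L P.1) (θ / 2) := funext fun P =>
        (hL _ (pauli_isHermitian P) (pauli_trace P)).map_eq _ _ rfl
      rw [h2, pauliMean_eq_sum fun X => expI (L X) (θ / 2)]
      congr 1
      exact Finset.sum_congr rfl fun t ht => by rw [h1 t (Finset.ne_of_mem_erase ht)]
    simp_rw [hmean]
    rw [average_eq, integral_smul, integral_finsetSum, smul_comm, Finset.smul_sum]
    · congr 1
      refine Finset.sum_congr rfl fun t ht => ?_
      have ht := Finset.ne_of_mem_erase ht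
      rw [← average_eq, average_expI_eq_starProjection (hgen t ht).selfAdjoint]
      rw [← (hgen t ht).map_eq (2 * Real.pi) 1, map_one, Submonoid.coe_one]
      rw [expI_of_sq_eq_one (A := Matrix (Qubits n) (Qubits n) ℂ) (pauliString_mul_self t)]
      simp
    · intro t _
      have : Continuous fun θ : ℝ => expI (h t) (θ / 2) :=
        (continuous_expI _).comp (continuous_id.div_const 2)
      exact (this.integrableOn_Icc (a := -(2 * Real.pi)) (b := 2 * Real.pi)).mono_set
        Set.Ioo_subset_Icc_self
  · by_cases ht : t = 0
    · rw [ht, h0, norm_zero]; exact hK0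
    · exact hK t ht _ (hgen t ht)

end PauliRotations

/-! ### Norm estimates for tensor products of unitaries. -/

section TensorNorms

theorem matrixTensor_update_one {k : ℕ} {ι : Type*} [DecidableEq ι] (j : Fin k) :
    matrixTensor (Function.update 1 j (1 : Matrix ι ι ℂ)) = 1 := by
  rw [show Function.update (1 : Fin k → Matrix ι ι ℂ) j 1 = 1 from Function.update_eq_self j 1]
  exact matrixTensor_one

variable {ι κ : Type*} [Fintype ι] [DecidableEq ι] [Fintype κ] [DecidableEq κ]

/-- The embedding `A ↦ A ⊗ 1`. -/
def kroneckerLeft : Matrix ι ι ℂ →⋆ₐ[ℂ] Matrix (ι × κ) (ι × κ) ℂ where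
  toFun A := A ⊗ₖ (1 : Matrix κ κ ℂ)
  map_one' := Matrix.one_kronecker_one
  map_mul' A B := by rw [← Matrix.mul_kronecker_mul, one_mul]
  map_zero' := Matrix.zero_kronecker _
  map_add' A B := Matrix.add_kronecker _ _ _
  commutes' c := by
    rw [Algebra.algebraMap_eq_smul_one, Algebra.algebraMap_eq_smul_one, Matrix.smul_kronecker,
      Matrix.one_kronecker_one]
  map_star' A := by
    rw [Matrix.star_eq_conjTranspose, Matrix.star_eq_conjTranspose, Matrix.conjTranspose_kronecker,
      Matrix.conjTranspose_one]

/-- The embedding `B ↦ 1 ⊗ B`. -/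
def kroneckerRight : Matrix κ κ ℂ →⋆ₐ[ℂ] Matrix (ι × κ) (ι × κ) ℂ where
  toFun B := (1 : Matrix ι ι ℂ) ⊗ₖ B
  map_one' := Matrix.one_kronecker_one
  map_mul' A B := by rw [← Matrix.mul_kronecker_mul, one_mul]
  map_zero' := Matrix.kronecker_zero _
  map_add' A B := Matrix.kronecker_add _ _ _
  commutes' c := by
    rw [Algebra.algebraMap_eq_smul_one, Algebra.algebraMap_eq_smul_one, Matrix.kronecker_smul,
      Matrix.one_kronecker_one]
  map_star' A := by
    rw [Matrix.star_eq_conjTranspose, Matrix.star_eq_conjTranspose, Matrix.conjTranspose_kronecker,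
      Matrix.conjTranspose_one]

theorem kronecker_mem_unitary {U : Matrix ι ι ℂ} {W : Matrix κ κ ℂ}
    (hU : U ∈ unitary (Matrix ι ι ℂ)) (hW : W ∈ unitary (Matrix κ κ ℂ)) :
    U ⊗ₖ W ∈ unitary (Matrix (ι × κ) (ι × κ) ℂ) := by
  have : U ⊗ₖ W = kroneckerLeft (κ := κ) U * kroneckerRight (ι := ι) W := by
    change _ = (U ⊗ₖ 1) * (1 ⊗ₖ W)
    rw [← Matrix.mul_kronecker_mul, one_mul, mul_one]
  rw [this]
  exact mul_mem (Unitary.map_mem kroneckerLeft hU) (Unitary.map_mem kroneckerRight hW)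

theorem norm_kronecker_sub_one_le {U : Matrix ι ι ℂ} {W : Matrix κ κ ℂ}
    (hU : U ∈ unitary (Matrix ι ι ℂ)) : ‖U ⊗ₖ W - 1‖ ≤ ‖U - 1‖ + ‖W - 1‖ := by
  have h1 : U ⊗ₖ W - 1 = kroneckerLeft (κ := κ) U * kroneckerRight (ι := ι) (W - 1) +
      kroneckerLeft (κ := κ) (U - 1) := by
    rw [map_sub, map_sub, map_one, map_one, mul_sub, mul_one]
    have : U ⊗ₖ W = kroneckerLeft (κ := κ) U * kroneckerRight (ι := ι) W := by
      change _ = (U ⊗ₖ 1) * (1 ⊗ₖ W)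
      rw [← Matrix.mul_kronecker_mul, one_mul, mul_one]
    rw [this]
    abel
  have h2 := norm_le_one_of_mem_unitary (Unitary.map_mem (kroneckerLeft (κ := κ)) hU)
  have h3 := NonUnitalStarAlgHom.norm_apply_le (kroneckerRight (ι := ι) (κ := κ)) (W - 1)
  have h4 := NonUnitalStarAlgHom.norm_apply_le (kroneckerLeft (ι := ι) (κ := κ)) (U - 1)
  rw [h1]
  refine (norm_add_le _ _).trans ?_
  have h5 := norm_mul_le (kroneckerLeft (κ := κ) U) (kroneckerRight (ι := ι) (W - 1))
  nlinarith [norm_nonneg (kroneckerRight (ι := ι) (W - 1))]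

theorem matrixTensor_mem_unitary {k : ℕ} {A : Fin k → Matrix ι ι ℂ}
    (hA : ∀ j, A j ∈ unitary (Matrix ι ι ℂ)) :
    matrixTensor A ∈ unitary (Matrix (Fin k → ι) (Fin k → ι) ℂ) := by
  rw [Unitary.mem_iff, matrixTensor_conjTranspose, matrixTensor_mul, matrixTensor_mul]
  simp_rw [(Unitary.mem_iff.mp (hA _)).1, (Unitary.mem_iff.mp (hA _)).2]
  exact ⟨matrixTensor_one, matrixTensor_one⟩

/-- The embedding of `A` as the `j`-th factor of a tensor power. -/
def tensorFactor {k : ℕ} (j : Fin k) :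
    Matrix ι ι ℂ →⋆ₐ[ℂ] Matrix (Fin k → ι) (Fin k → ι) ℂ where
  toFun A := matrixTensor (Function.update 1 j A)
  map_one' := matrixTensor_update_one j
  map_mul' A B := by
    rw [matrixTensor_mul]
    congr 1
    funext i
    by_cases hi : i = j
    · subst hi; simp
    · simp [hi]
  map_zero' := by
    ext x y
    rw [matrixTensor_update_apply]
    simp
  map_add' A B := by
    ext x y
    simp only [matrixTensor_update_apply, Matrix.add_apply, add_mul]
  commutes' c := by
    rw [Algebra.algebraMap_eq_smul_one, Algebra.algebraMap_eq_smul_one]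
    rw [← matrixTensor_update_one j]
    ext x y
    simp only [matrixTensor_update_apply, Matrix.smul_apply, smul_eq_mul, mul_assoc]
  map_star' A := by
    rw [matrixTensor_conjTranspose]
    congr 1
    funext i
    by_cases hi : i = j
    · subst hi; simp
    · simp [hi]

theorem norm_matrixTensorPow_sub_one_le {A : Matrix ι ι ℂ} (hA : A ∈ unitary (Matrix ι ι ℂ))
    (t : ℕ) : ‖matrixTensorPow t A - 1‖ ≤ t * ‖A - 1‖ := by
  -- The factors are switched from `1` to `A` one at a time, each switch costing at most `‖A - 1‖`.
  have key : ∀ s : Finset (Fin t),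
      ‖matrixTensor (fun j => if j ∈ s then A else 1) - 1‖ ≤ s.card * ‖A - 1‖ := by
    intro s
    induction s using Finset.induction_on with
    | empty =>
      simp [matrixTensor_one]
    | insert j s hj ih =>
      have h1 : matrixTensor (fun i => if i ∈ insert j s then A else 1) =
          tensorFactor j A * matrixTensor (fun i => if i ∈ s then A else 1) := by
        change _ = matrixTensor (Function.update 1 j A) * _
        rw [matrixTensor_mul]
        congr 1
        funext i
        by_cases hi : i = j
        · subst hi; simp [hj]
        · simp [hi]
      have h2 : matrixTensor (fun i => if i ∈ insert j s then A else 1) - 1 =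
          tensorFactor j A * (matrixTensor (fun i => if i ∈ s then A else 1) - 1) +
            tensorFactor j (A - 1) := by
        rw [h1, map_sub, map_one, mul_sub, mul_one]
        abel
      have h3 := norm_le_one_of_mem_unitary (Unitary.map_mem (tensorFactor j) hA)
      have h4 := NonUnitalStarAlgHom.norm_apply_le (tensorFactor j) (A - 1)
      have h5 := norm_mul_le (tensorFactor j A)
        (matrixTensor (fun i => if i ∈ s then A else 1) - 1)
      rw [h2, Finset.card_insert_of_notMem hj]
      refine (norm_add_le _ _).trans ?_
      push_cast
      nlinarith [norm_nonneg (matrixTensor (fun i => if i ∈ s then A else 1) - 1)]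
  simpa [matrixTensorPow] using key Finset.univ

end TensorNorms

/-! ### The representation `(U ⊗ Ū) ^ ⊗ t`. -/

section TensorRepresentation

variable {n : ℕ}

theorem map_star_mem_unitary {ι : Type*} [Fintype ι] [DecidableEq ι] {U : Matrix ι ι ℂ}
    (hU : U ∈ unitary (Matrix ι ι ℂ)) : U.map star ∈ unitary (Matrix ι ι ℂ) := by
  have h1 : ∀ M N : Matrix ι ι ℂ, M.map star * N.map star = (M * N).map star := fun M N =>
    (Matrix.map_mul (f := starRingEnd ℂ)).symm
  have h2 : star (U.map star) = (star U).map star := rfl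
  have h3 : (1 : Matrix ι ι ℂ).map star = 1 := Matrix.map_one _ (star_zero _) (star_one _)
  rw [Unitary.mem_iff, h2, h1, h1, (Unitary.mem_iff.mp hU).1, (Unitary.mem_iff.mp hU).2, h3]
  exact ⟨rfl, rfl⟩

/-- The matrix representation `U ↦ (U ⊗ Ū) ^ ⊗ t`. -/
def tensorRepMatrix (t : ℕ) :
    SU n →* unitary (Matrix (Fin t → Qubits n × Qubits n) (Fin t → Qubits n × Qubits n) ℂ) where
  toFun U := ⟨matrixTensorPow t (U.1 ⊗ₖ U.1.map star),
    matrixTensor_mem_unitary fun _ => kronecker_mem_unitary U.2.1 (map_star_mem_unitary U.2.1)⟩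
  map_one' := Subtype.ext <| by
    change matrixTensorPow t ((1 : Matrix (Qubits n) (Qubits n) ℂ) ⊗ₖ
      (1 : Matrix (Qubits n) (Qubits n) ℂ).map star) = 1
    rw [Matrix.map_one _ (star_zero _) (star_one _), Matrix.one_kronecker_one]
    exact matrixTensor_one
  map_mul' U W := Subtype.ext <| by
    change matrixTensorPow t ((U.1 * W.1) ⊗ₖ (U.1 * W.1).map star) =
      matrixTensorPow t _ * matrixTensorPow t _
    have h1 : (U.1 * W.1).map star = U.1.map star * W.1.map star :=
      Matrix.map_mul (f := starRingEnd ℂ)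
    rw [h1, Matrix.mul_kronecker_mul]
    exact (matrixTensor_mul _ _).symm

theorem continuous_tensorRepMatrix (t : ℕ) : Continuous (tensorRepMatrix (n := n) t) := by
  refine Continuous.subtype_mk ?_ _
  refine continuous_matrix fun x y => ?_
  simp only [matrixTensorPow, matrixTensor, Matrix.of_apply, Matrix.kroneckerMap_apply,
    Matrix.map_apply]
  refine continuous_finsetProd _ fun j _ => ?_
  exact (continuous_subtype_val.matrix_elem _ _).mul
    (continuous_star.comp (continuous_subtype_val.matrix_elem _ _))

/-- The representation `U ↦ (U ⊗ Ū) ^ ⊗ t` by unitary operators. -/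
def tensorRep (t : ℕ) :
    SU n →* unitary (EuclideanSpace ℂ (Fin t → Qubits n × Qubits n) →L[ℂ]
      EuclideanSpace ℂ (Fin t → Qubits n × Qubits n)) where
  toFun U := ⟨Matrix.toEuclideanCLM (𝕜 := ℂ) (tensorRepMatrix t U).1,
    Unitary.map_mem _ (tensorRepMatrix t U).2⟩
  map_one' := Subtype.ext <| by simp
  map_mul' U W := Subtype.ext <| by simp

theorem norm_toEuclideanCLM {m : Type*} [Fintype m] [DecidableEq m] (A : Matrix m m ℂ) :
    ‖Matrix.toEuclideanCLM (𝕜 := ℂ) A‖ = ‖A‖ :=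
  Matrix.l2_opNorm_toEuclideanCLM A

theorem continuous_toEuclideanCLM {m : Type*} [Fintype m] [DecidableEq m] :
    Continuous fun A : Matrix m m ℂ => Matrix.toEuclideanCLM (𝕜 := ℂ) A :=
  LinearMap.continuous_of_finiteDimensional
    (Matrix.toEuclideanCLM (𝕜 := ℂ) (n := m)).toAlgEquiv.toLinearMap

theorem continuous_tensorRep (t : ℕ) : Continuous (tensorRep (n := n) t) :=
  (continuous_toEuclideanCLM.comp
    (continuous_subtype_val.comp (continuous_tensorRepMatrix t))).subtype_mk _

theorem expI_map_star {m : Type*} [Fintype m] [DecidableEq m] (X : Matrix m m ℂ) (θ : ℝ) :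
    (expI X θ).map star = expI (X.map star) (-θ) := by
  have h1 : ∀ M : Matrix m m ℂ, M.map star = Mᴴᵀ := fun _ => rfl
  rw [h1, expI, expI, ← Matrix.exp_conjTranspose, ← Matrix.exp_transpose, h1]
  congr 1
  rw [Matrix.conjTranspose_smul, Matrix.transpose_smul]
  congr 1
  simp

theorem pauliString_mem_unitary (s : Fin n → Fin 4) :
    pauliString s ∈ unitary (Matrix (Qubits n) (Qubits n) ℂ) := by
  have : star (pauliString s) = pauliString s := pauliString_isHermitian s
  rw [Unitary.mem_iff, this, pauliString_mul_self]
  exact ⟨rfl, rfl⟩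

/-- There are `2 * t` tensor factors, each a rotation at distance at most `|θ|` from `1` since Pauli
strings are unitary. -/
theorem norm_generator_tensorRep_le (t : ℕ) {s : Fin n → Fin 4} (hs : s ≠ 0)
    {a : EuclideanSpace ℂ (Fin t → Qubits n × Qubits n) →L[ℂ]
      EuclideanSpace ℂ (Fin t → Qubits n × Qubits n)}
    (ha : IsGenerator (tensorRep t) (pauliString s) a) : ‖a‖ ≤ 2 * t := by
  refine norm_le_of_norm_expI_sub_one_le (by positivity) fun θ => ?_
  have hH := pauliString_isHermitian s
  set U := suExp hH (pauliString_trace hs) θ with hU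
  rw [← ha.map_eq θ U rfl]
  have h1 : ((tensorRep t U : _ →L[ℂ] _) - 1) =
      Matrix.toEuclideanCLM (𝕜 := ℂ) (matrixTensorPow t (U.1 ⊗ₖ U.1.map star) - 1) := by
    rw [map_sub, map_one]
    rfl
  have hUu : U.1 ∈ unitary (Matrix (Qubits n) (Qubits n) ℂ) := U.2.1
  have h2 := norm_matrixTensorPow_sub_one_le
    (kronecker_mem_unitary hUu (map_star_mem_unitary hUu)) t
  have h3 := norm_kronecker_sub_one_le (W := U.1.map star) hUu
  have h4 : ‖U.1 - 1‖ ≤ |θ| := by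
    refine (norm_expI_sub_one_le (A := Matrix (Qubits n) (Qubits n) ℂ) hH θ).trans ?_
    exact mul_le_of_le_one_left (abs_nonneg _)
      (norm_le_one_of_mem_unitary (pauliString_mem_unitary s))
  have h5 : ‖U.1.map star - 1‖ ≤ |θ| := by
    have hH' : IsSelfAdjoint ((pauliString s).map star) :=
      congrArg (fun M : Matrix (Qubits n) (Qubits n) ℂ => M.map star) hH
    change ‖(expI (pauliString s) θ).map star - 1‖ ≤ |θ|
    rw [expI_map_star]
    refine (norm_expI_sub_one_le hH' (-θ)).trans ?_
    rw [abs_neg]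
    exact mul_le_of_le_one_left (abs_nonneg _)
      (norm_le_one_of_mem_unitary (map_star_mem_unitary (pauliString_mem_unitary s)))
  rw [h1, norm_toEuclideanCLM]
  calc _ ≤ (t : ℝ) * _ := h2
    _ ≤ t * (|θ| + |θ|) := by gcongr; linarith
    _ = _ := by ring

theorem average_Ioo_eq_of_periodic {E : Type*} [NormedAddCommGroup E] [NormedSpace ℝ E]
    {f : ℝ → E} (hf : Continuous f) {T : ℝ} (hT : 0 < T) (hper : Function.Periodic f (2 * T)) :
    ⨍ θ in Set.Ioo (-T) T, f θ = ⨍ θ in Set.Ioo (-(2 * T)) (2 * T), f θ := by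
  have h1 : ∀ S : ℝ, 0 < S → ⨍ θ in Set.Ioo (-S) S, f θ =
      (2 * S)⁻¹ • ∫ θ in (-S)..S, f θ := by
    intro S hS
    rw [setAverage_eq, intervalIntegral.integral_of_le (by linarith), integral_Ioc_eq_integral_Ioo,
      Real.volume_real_Ioo_of_le (by linarith)]
    congr 2
    ring
  rw [h1 T hT, h1 (2 * T) (by positivity)]
  have hi : ∀ a b, IntervalIntegrable f volume a b := fun a b => hf.intervalIntegrable a b
  rw [← intervalIntegral.integral_add_adjacent_intervals (hi (-(2 * T)) 0) (hi 0 (2 * T))]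
  have h2 := hper.intervalIntegral_add_eq (-(2 * T)) (-T)
  have h3 := hper.intervalIntegral_add_eq 0 (-T)
  rw [neg_add_cancel, show -T + 2 * T = T by ring] at h2
  rw [zero_add, show -T + 2 * T = T by ring] at h3
  rw [h2, h3, ← two_smul ℝ, smul_smul]
  congr 1
  field_simp

theorem matrixTensorPow_pauliRotation (t : ℕ) (P : pauliSet n) (θ : ℝ) :
    matrixTensorPow t (NormedSpace.exp ((Complex.I * ((θ / 2 : ℝ) : ℂ)) • P.1) ⊗ₖ
      NormedSpace.exp ((-Complex.I * ((θ / 2 : ℝ) : ℂ)) • P.1.map star)) =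
      (tensorRepMatrix t (pauliRotation P θ)).1 := by
  have h1 : NormedSpace.exp ((-Complex.I * ((θ / 2 : ℝ) : ℂ)) • P.1.map star) =
      (expI P.1 (θ / 2)).map star := by
    rw [expI_map_star, expI]
    congr 2
    push_cast
    ring
  rw [h1]
  rfl

/-- A shift by `2π` multiplies the rotation by `-1`, and the sign cancels in `U ⊗ Ū`. This is why
`(-π, π)` suffices here. -/
theorem periodic_tensorRepMatrix_pauliRotation (t : ℕ) (P : pauliSet n) (θ : ℝ) :
    tensorRepMatrix t (pauliRotation P (θ + 2 * Real.pi)) =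
      tensorRepMatrix t (pauliRotation P θ) := by
  obtain ⟨s, -, hs⟩ := Finset.mem_image.mp ((Finset.ext_iff.mp pauliSet_eq_image P.1).mp P.2)
  have h1 : (pauliRotation P (θ + 2 * Real.pi)).1 = -(pauliRotation P θ).1 := by
    change expI P.1 ((θ + 2 * Real.pi) / 2) = -expI P.1 (θ / 2)
    rw [show (θ + 2 * Real.pi) / 2 = θ / 2 + Real.pi by ring, expI_add,
      expI_of_sq_eq_one (a := P.1) (θ := Real.pi) (by rw [← hs, pauliString_mul_self])]
    simp
  refine Subtype.ext ?_
  change matrixTensorPow t (_ ⊗ₖ _) = matrixTensorPow t (_ ⊗ₖ _)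
  rw [h1]
  congr 1
  ext x y
  simp

theorem continuous_pauliRotation (P : pauliSet n) : Continuous (pauliRotation P) :=
  ((continuous_expI P.1).comp (continuous_id.div_const 2)).subtype_mk _

theorem continuous_pauliMean {E : Type*} [NormedAddCommGroup E] [NormedSpace ℝ E]
    {f : ℝ → pauliSet n → E} (hf : ∀ P, Continuous fun θ => f θ P) :
    Continuous fun θ => pauliMean n (f θ) :=
  (continuous_finsetSum _ fun P _ => hf P).const_smul _

end TensorRepresentation

end

/-! ### The two bounds. -/

theorem theorem1 (n : ℕ) (hn : 1 ≤ n) :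
    (∀ t : ℕ, 1 ≤ t →
      ‖(⨍ θ in Set.Ioo (-Real.pi) Real.pi, pauliMean n fun P =>
            matrixTensorPow t
              (NormedSpace.exp ((Complex.I * ((θ / 2 : ℝ) : ℂ)) • P.1) ⊗ₖ
                NormedSpace.exp ((-Complex.I * ((θ / 2 : ℝ) : ℂ)) • P.1.map star)))
          - ∫ U : SU n, matrixTensorPow t (U.1 ⊗ₖ U.1.map star) ∂haarSU n‖
        ≤ 1 - 1 / (4 * (t : ℝ)) - 1 / ((4 : ℝ) ^ n - 1)) ∧
    (∀ (V : Type*) [NormedAddCommGroup V] [InnerProductSpace ℂ V] [FiniteDimensional ℂ V]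
      [CompleteSpace V] (ρ : SU n →* unitary (V →L[ℂ] V)), Continuous ρ →
      ‖(⨍ θ in Set.Ioo (-(2 * Real.pi)) (2 * Real.pi), pauliMean n fun P =>
            (ρ (pauliRotation P θ) : V →L[ℂ] V))
          - ∫ U : SU n, (ρ U : V →L[ℂ] V) ∂haarSU n‖
        ≤ 1 - 1 / ((4 : ℝ) ^ n - 1)) := by
  have hm : (4 : ℝ) ≤ (4 : ℝ) ^ n := le_self_pow₀ (by norm_num) (by omega)
  have hm0 : (0 : ℝ) < (4 : ℝ) ^ n - 1 := by linarith
  have hm3 : 1 / ((4 : ℝ) ^ n - 1) ≤ 1 / 3 := one_div_le_one_div_of_le (by norm_num) (by linarith)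
  constructor
  · intro t ht
    have ht1 : (1 : ℝ) ≤ t := by exact_mod_cast ht
    have ht4 : 1 / (4 * (t : ℝ)) ≤ 1 / 4 := one_div_le_one_div_of_le (by norm_num) (by linarith)
    have hgap := norm_pauliMean_sub_haar_le (ρ := tensorRep t) hn (continuous_tensorRep t)
      (K := 2 * t) (g := 1 / (4 * (t : ℝ)) + 1 / ((4 : ℝ) ^ n - 1)) (by positivity)
      (fun s hs a ha => norm_generator_tensorRep_le t hs ha) (by linarith)
      -- With `K = 2 t` the left side is `(4 ^ n - 1) / 2 + 2 t`, so the two sides differ only by `1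
      -- / 2`.
      (le_of_eq_of_le (b := ((4 : ℝ) ^ n - 1) / 2 + 2 * t) (by field_simp; ring) (by linarith))
    let Φ := (Matrix.toEuclideanCLM (𝕜 := ℂ)
      (n := Fin t → Qubits n × Qubits n)).toAlgEquiv.toLinearEquiv.toContinuousLinearEquiv
    have hΦ : ∀ M, Φ M = Matrix.toEuclideanCLM (𝕜 := ℂ) M := fun _ => rfl
    simp_rw [matrixTensorPow_pauliRotation]
    -- The interval is doubled by periodicity, and matrices are carried isometrically to operators
    -- on Euclidean space, where the gap bound applies.
    rw [average_Ioo_eq_of_periodic _ Real.pi_pos, ← norm_toEuclideanCLM, ← hΦ, map_sub,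
      average_eq, map_real_smul Φ Φ.continuous, ← Φ.integral_comp_comm, ← Φ.integral_comp_comm,
      ← average_eq]
    · rw [sub_sub]
      convert hgap using 4
      · funext θ
        rw [pauliMean, pauliMean, map_real_smul Φ Φ.continuous, map_sum]
        rfl
      · rfl
    · intro θ
      simp only [periodic_tensorRepMatrix_pauliRotation]
    · exact continuous_pauliMean fun P => continuous_subtype_val.comp
        ((continuous_tensorRepMatrix t).comp (continuous_pauliRotation P))
  · intro V _ _ _ _ ρ hρ
    obtain ⟨L, hL⟩ := exists_linear_generator hρ
    -- Any finite bound `K` works: with `g = 1 / (4 ^ n - 1)` the condition is `K ≤ K + 4 ^ n / 2`.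
    refine norm_pauliMean_sub_haar_le hn hρ (K := ∑ s, ‖L (pauliString s)‖)
      (Finset.sum_nonneg fun _ _ => norm_nonneg _) (fun s hs a ha => ?_) (by linarith) ?_
    · have hH := pauliString_isHermitian s
      have htr := pauliString_trace hs
      rw [ha.unique hH htr (hL _ hH htr)]
      exact Finset.single_le_sum (f := fun s => ‖L (pauliString s)‖) (fun _ _ => norm_nonneg _)
        (Finset.mem_univ s)
    · rw [one_div, inv_mul_cancel₀ hm0.ne', one_mul]
      linarith
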